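/- Let $n \ge 1$ and let $H_1, H_2, H_3$ be Hermitian $n\times n$ matrices. For $z,\zeta\in\mathbf C^n$ put $\langle z,\bar\zeta\rangle = (H_1 z\cdot\bar\zeta,\ H_2 z\cdot\bar\zeta,\ H_3 z\cdot\bar\zeta)\in\mathbf C^3$, where $z\cdot\bar\zeta=\sum_i z_i\bar\zeta_i$, and consider the quadric of codimension $3$ $$\mathcal Q=\{(z,w)\in\mathbf C^n\times\mathbf C^3 : \operatorname{Im} w=\langle z,\bar z\rangle\}.$$ Suppose that $\mathcal Q$ is nondegenerate, that is: (1) if $\langle e,\bar z\rangle=0$ for all $z\in\mathbf C^n$, then $e=0$; (2) the three coordinate forms $H_j z\cdot\bar z$ are linearly independent over $\mathbf R$. Let $\operatorname{aut}\mathcal Q$ be the space of germs at the origin of vector fields $X=2\operatorname{Re}\bigl(f(z,w)\,\partial/\partial z+g(z,w)\,\partial/\partial w\bigr)$, with $f,g$ germs of holomorphic maps into $\mathbf C^n$ and $\mathbf C^3$, that are tangent to $\mathcal Q$. Assign weights $[z]=1$, $[w]=2$, $[\partial/\partial z]=-1$, $[\partial/\partial w]=-2$, and for $m\in\mathbf Z$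 let $g_m\subset\operatorname{aut}\mathcal Q$ be the real subspace of the fields of weight $m$, i.e. those for which $f$ and $g$ are weighted homogeneous polynomial maps of weights $m+1$ and $m+2$. The quadric $\mathcal Q$ is called exceptional if it is nondegenerate and $g_3\neq 0$. Then $\mathcal Q$ is not exceptional, the subspaces $g_m$ ($m\in\mathbf Z$) are linearly independent, and $$\operatorname{aut}\mathcal Q=g_{-2}\oplus g_{-1}\oplus g_0\oplus g_1\oplus g_2 .$$ -/

import Mathlib

open scoped Topology Matrix

noncomputable section

/-- The complex space `ℂⁿ × ℂᵏ` with coordinates `(z, w)`. -/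
abbrev CxSpace (n k : ℕ) : Type := (Fin n → ℂ) × (Fin k → ℂ)

/-- The data of a quadric of CR-dimension `n` and codimension `k`: a `k`-tuple of Hermitian
forms on `ℂⁿ`, given by their Hermitian matrices `H₁, …, H_k`. -/
structure CRQuadric (n k : ℕ) where
  mat : Fin k → Matrix (Fin n) (Fin n) ℂ
  isHermitian : ∀ j, (mat j).IsHermitian

namespace CRQuadric

variable {n k : ℕ}

/-- The vector-valued Hermitian form `⟨z, ζ̄⟩ = (H₁ z · ζ̄, …, H_k z · ζ̄)`, linear in `z` and
antilinear in `ζ`. -/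
def form (Q : CRQuadric n k) (z ζ : Fin n → ℂ) : Fin k → ℂ :=
  fun j => star ζ ⬝ᵥ (Q.mat j *ᵥ z)

/-- The defining function `v - ⟨z, z̄⟩`, where `v = Im w` (the numbers `⟨z, z̄⟩_j` are real). -/
def definingFun (Q : CRQuadric n k) (p : CxSpace n k) : Fin k → ℝ :=
  fun j => (p.2 j).im - (Q.form p.1 p.1 j).re

/-- The quadric `{v = ⟨z, z̄⟩}` as a subset of `ℂⁿ × ℂᵏ`. -/
def carrier (Q : CRQuadric n k) : Set (CxSpace n k) :=
  {p | Q.definingFun p = 0}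

/-- Nondegeneracy: the coordinate forms have no common kernel and are linearly independent
over `ℝ`. -/
def Nondegenerate (Q : CRQuadric n k) : Prop :=
  (∀ e : Fin n → ℂ, (∀ z, Q.form e z = 0) → e = 0) ∧ LinearIndependent ℝ Q.mat

/-- Germs at the origin of maps `ℂⁿ × ℂᵏ → ℂⁿ × ℂᵏ`. A holomorphic germ `(f, g)` stands for the
real vector field `2 Re (f ∂/∂z + g ∂/∂w)`, whose value at a point `p`, as a real tangent vector
of `ℂⁿ × ℂᵏ`, is `(f p, g p)`. -/
abbrev FieldGerm (n k : ℕ) : Type := Filter.Germ (𝓝 (0 : CxSpace n k)) (CxSpace n k)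

lemma differentiable_definingFun (Q : CRQuadric n k) : Differentiable ℝ Q.definingFun := by
  rw [differentiable_pi]
  intro j
  have h1 : Differentiable ℝ fun p : CxSpace n k => (p.2 j).im :=
    Complex.imCLM.differentiable.comp (by fun_prop)
  have h2 : Differentiable ℝ fun p : CxSpace n k => Q.form p.1 p.1 j := by
    have h3 : ∀ i, Differentiable ℝ fun p : CxSpace n k => star (p.1 i) := fun i =>
      Complex.conjCLE.differentiable.comp (f := fun p : CxSpace n k => p.1 i) (by fun_prop)
    simp only [form, dotProduct, Matrix.mulVec, Pi.star_apply]
    refine Differentiable.fun_sum fun i _ => (h3 i).mul ?_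
    fun_prop
  exact h1.sub (Complex.reCLM.differentiable.comp h2)

/-- The real vector space `aut Q` of germs at the origin of infinitesimal holomorphic
automorphisms: germs of holomorphic `X = (f, g)` whose real vector field is tangent to the
quadric at all points of the quadric near the origin. -/
def aut (Q : CRQuadric n k) : Submodule ℝ (FieldGerm n k) where
  carrier := {G | ∃ X : CxSpace n k → CxSpace n k, G = (X : FieldGerm n k) ∧
    AnalyticAt ℂ X 0 ∧
    ∀ᶠ p in 𝓝 (0 : CxSpace n k), p ∈ Q.carrier → fderiv ℝ Q.definingFun p (X p) = 0}
  zero_mem' := ⟨0, rfl, analyticAt_const, by simp⟩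
  add_mem' := by
    rintro _ _ ⟨X, rfl, hX, hX'⟩ ⟨Y, rfl, hY, hY'⟩
    refine ⟨X + Y, rfl, hX.add hY, ?_⟩
    filter_upwards [hX', hY'] with p h1 h2 hp
    simp [h1 hp, h2 hp]
  smul_mem' := by
    rintro c _ ⟨X, rfl, hX, hX'⟩
    refine ⟨c • X, rfl, ?_, ?_⟩
    · have h : AnalyticAt ℂ ((c : ℂ) • X) 0 := analyticAt_const.smul hX
      have e : c • X = (c : ℂ) • X := by
        funext p
        ext <;> simp
      rwa [e]
    · filter_upwards [hX'] with p h1 hp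
      simp [h1 hp]

/-- The weights of the variables: `[z] = 1`, `[w] = 2`. -/
def varWeight (n k : ℕ) : Fin n ⊕ Fin k → ℤ := Sum.elim (fun _ => 1) (fun _ => 2)

/-- The map `ℂⁿ × ℂᵏ → ℂⁿ × ℂᵏ` given by polynomial components `(f, g)`. -/
def polyField (f : Fin n → MvPolynomial (Fin n ⊕ Fin k) ℂ)
    (g : Fin k → MvPolynomial (Fin n ⊕ Fin k) ℂ) : CxSpace n k → CxSpace n k :=
  fun p => (fun i => MvPolynomial.eval (Sum.elim p.1 p.2) (f i),
    fun j => MvPolynomial.eval (Sum.elim p.1 p.2) (g j))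

/-- The germs of holomorphic vector fields of weight `m`: since `∂/∂z` has weight `-1` and `∂/∂w`
has weight `-2`, these are the polynomial fields `(f, g)` with `f` weighted homogeneous of weight
`m + 1` and `g` weighted homogeneous of weight `m + 2`. -/
def weightSpace (n k : ℕ) (m : ℤ) : Submodule ℝ (FieldGerm n k) where
  carrier := {G | ∃ f g, G = (polyField f g : FieldGerm n k) ∧
    (∀ i, (f i).IsWeightedHomogeneous (varWeight n k) (m + 1)) ∧
    ∀ j, (g j).IsWeightedHomogeneous (varWeight n k) (m + 2)}
  zero_mem' := by
    refine ⟨0, 0, ?_, fun i => MvPolynomial.isWeightedHomogeneous_zero _ _ _,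
      fun i => MvPolynomial.isWeightedHomogeneous_zero _ _ _⟩
    have e : polyField (n := n) (k := k) 0 0 = 0 := by
      funext p
      ext <;> simp [polyField]
    rw [e]
    rfl
  add_mem' := by
    rintro _ _ ⟨f, g, rfl, hf, hg⟩ ⟨f', g', rfl, hf', hg'⟩
    refine ⟨f + f', g + g', ?_, fun i => (hf i).add (hf' i), fun j => (hg j).add (hg' j)⟩
    have e : polyField (f + f') (g + g') = polyField f g + polyField f' g' := by
      funext p
      ext <;> simp [polyField]
    rw [e]
    rfl
  smul_mem' := by
    rintro c _ ⟨f, g, rfl, hf, hg⟩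
    refine ⟨fun i => (c : ℂ) • f i, fun j => (c : ℂ) • g j, ?_,
      fun i => (MvPolynomial.weightedHomogeneousSubmodule ℂ _ _).smul_mem _ (hf i),
      fun j => (MvPolynomial.weightedHomogeneousSubmodule ℂ _ _).smul_mem _ (hg j)⟩
    have e : polyField (fun i => (c : ℂ) • f i) (fun j => (c : ℂ) • g j) = c • polyField f g := by
      funext p
      ext <;> simp [polyField, MvPolynomial.smul_eval, -Complex.coe_smul]
    rw [e]
    rfl

/-- The weight component `g_m` of `aut Q`. -/
def autComp (Q : CRQuadric n k) (m : ℤ) : Submodule ℝ (FieldGerm n k) :=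
  Q.aut ⊓ weightSpace n k m

/-- A quadric is exceptional if it is nondegenerate and `g₃ ≠ 0`. -/
def IsExceptional (Q : CRQuadric n k) : Prop :=
  Q.Nondegenerate ∧ Q.autComp 3 ≠ ⊥

end CRQuadric

end

/-! The heart of the matter is that a tangent polynomial field of weight at least three vanishes.
Real dilations `(z, w) ↦ (s z, s² w)` preserve the quadric, so the weight parts of long Taylor jets
of a tangent field are tangent (`tangency_weightPart`). Killing weights `≥ 3` then leaves a
polynomial field with parts of weights `-2, …, 2` (`aut_le`). Distinct weights are distinct
eigenvalues of a dilation pullback, so the components are independent, and this also forces `g₃ =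
0`.

For the vanishing, let `B` be the bilinear extension of the form, and let `ζ` and `w - 2i B z ζ`
replace the conjugates of `z` and `w` in the tangency equation. The substitution `z ↦ s z`, `ζ ↦ ζ /
s` fixes `B z ζ`. As `s → ∞` it shows that `B z (f' 0 (w + t B z ζ))` is affine in `t`, where `f'`
is the conjugate of `f`. Hence the second derivative `b` of `f' 0` satisfies `B z (b q q) = 0` for
`q = B z ζ`. Codimension three enters through `symm_bilin_eq_zero`, which says that such a `b` is
zero. After Heisenberg translations `f` is affine in `w`, and for weights `≥ 3` homogeneity and the
same limit force `f = 0` and then `g = 0` (`ComplexTangent.eq_zero`).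

In the algebraic theorem, if some `B z` is onto, all nearby ones are, and nondegeneracy gives `b =
0`. Otherwise a nonzero `e = b p p` with `p = B z ζ` would make the values `B y e` fill a line. A
rank argument extends this line to `B (V × U)` for a hyperplane `U`, and Hermitian symmetry yields a
contradiction. Thus `b p p = 0` for all values `p`, and the dependence of four vectors in `ℂ³` gives
`b = 0`. -/

noncomputable section

/-! ### Linear algebra of bilinear maps into `ℂ³` -/

/-- Two linearly independent bilinear forms whose values at each left argument are proportional
vanish on a common hyperplane of right arguments. -/
lemma exists_common_ker_of_proportional {V : Type*} [AddCommGroup V] [Module ℂ V]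
    (G₁ G₂ : V →ₗ[ℂ] V →ₗ[ℂ] ℂ)
    (hprop : ∀ z ζ ζ', G₁ z ζ * G₂ z ζ' = G₁ z ζ' * G₂ z ζ)
    (hind : ∀ c₁ c₂ : ℂ, (∀ z ζ, c₁ * G₁ z ζ + c₂ * G₂ z ζ = 0) → c₁ = 0 ∧ c₂ = 0) :
    ∃ ψ : V →ₗ[ℂ] ℂ, ψ ≠ 0 ∧ ∀ z ζ, ψ ζ = 0 → G₁ z ζ = 0 ∧ G₂ z ζ = 0 := by
  obtain ⟨z₀, ζ₀, h₀⟩ : ∃ z ζ, G₁ z ζ ≠ 0 := by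
    by_contra! h
    have := (hind 1 0 (by simp [h])).1
    exact one_ne_zero this
  have hpol : ∀ z y ζ ζ', G₁ z ζ * G₂ y ζ' + G₁ y ζ * G₂ z ζ' =
      G₁ z ζ' * G₂ y ζ + G₁ y ζ' * G₂ z ζ := by
    intro z y ζ ζ'
    have h := hprop (z + y) ζ ζ'
    simp only [map_add, LinearMap.add_apply] at h
    linear_combination h - hprop z ζ ζ' - hprop y ζ ζ'
  set c := G₂ z₀ ζ₀ / G₁ z₀ ζ₀ with hc
  have hc' : G₂ z₀ ζ₀ = c * G₁ z₀ ζ₀ := by rw [hc]; field_simp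
  have hz₀ : ∀ ζ, G₂ z₀ ζ - c * G₁ z₀ ζ = 0 := by
    intro ζ
    have h := hprop z₀ ζ₀ ζ
    rw [hc'] at h
    exact mul_left_cancel₀ h₀ (by linear_combination h)
  obtain ⟨y₀, ζ₁, h₁⟩ : ∃ z ζ, G₂ z ζ - c * G₁ z ζ ≠ 0 := by
    by_contra! h
    have := (hind (-c) 1 (by intro z ζ; linear_combination h z ζ)).2
    exact one_ne_zero this
  refine ⟨G₁ z₀, fun h => h₀ (by simp [h]), fun y ζ hζ => ?_⟩
  -- The relation persists when `G₂` is replaced by `G₂ - c G₁`, which vanishes at `z₀`. Polarizing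
  -- between `z₀` and `y` leaves only the term with the nonzero factor `G₁ z₀ ζ₀`.
  have hG₂ : ∀ y, G₂ y ζ - c * G₁ y ζ = 0 := by
    intro y
    refine mul_left_cancel₀ h₀ ?_
    linear_combination hpol z₀ y ζ₀ ζ - G₁ y ζ₀ * hz₀ ζ + G₁ y ζ * hz₀ ζ₀ +
      (G₂ y ζ₀ - c * G₁ y ζ₀) * hζ
  have hy₀ : G₁ y₀ ζ = 0 := by
    refine mul_right_cancel₀ h₁ ?_
    linear_combination hprop y₀ ζ ζ₁ + G₁ y₀ ζ₁ * hG₂ y₀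
  -- The same polarization, now between `y` and `y₀`, with nonzero factor `G₂ y₀ ζ₁ - c G₁ y₀ ζ₁`.
  have hy : G₁ y ζ = 0 := by
    refine mul_right_cancel₀ h₁ ?_
    linear_combination hpol y y₀ ζ ζ₁ + G₁ y ζ₁ * hG₂ y₀ + G₁ y₀ ζ₁ * hG₂ y -
      (G₂ y ζ₁ - c * G₁ y ζ₁) * hy₀
  exact ⟨hy, by linear_combination hG₂ y + c * hy⟩

section BilinearMap

variable {n : ℕ} (B : (Fin n → ℂ) →ₗ[ℂ] (Fin n → ℂ) →ₗ[ℂ] (Fin 3 → ℂ))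

/-- A symmetric bilinear map on `ℂ³` that vanishes on the squares of the values of a bilinear map
with spanning values vanishes. -/
lemma symm_bilin_eq_zero_of_apply_self
    (hspan : ∀ c : (Fin 3 → ℂ) →ₗ[ℂ] ℂ, (∀ z ζ, c (B z ζ) = 0) → c = 0)
    (b : (Fin 3 → ℂ) →ₗ[ℂ] (Fin 3 → ℂ) →ₗ[ℂ] (Fin n → ℂ)) (hsymm : ∀ p q, b p q = b q p)
    (h : ∀ z ζ, b (B z ζ) (B z ζ) = 0) : b = 0 := by
  have hζ : ∀ z ζ ζ', b (B z ζ) (B z ζ') = 0 := by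
    intro z ζ ζ'
    have h1 := h z (ζ + ζ')
    simp only [map_add, LinearMap.add_apply, h, hsymm (B z ζ') (B z ζ), zero_add, add_zero,
      ← two_smul ℂ] at h1
    simpa using h1
  have hz : ∀ z z' ζ, b (B z ζ) (B z' ζ) = 0 := by
    intro z z' ζ
    have h1 := h (z + z') ζ
    simp only [map_add, LinearMap.add_apply, h, hsymm (B z' ζ) (B z ζ), zero_add, add_zero,
      ← two_smul ℂ] at h1
    simpa using h1
  have hanti : ∀ z z' ζ ζ', b (B z ζ') (B z' ζ) = - b (B z ζ) (B z' ζ') := by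
    intro z z' ζ ζ'
    have h1 := hz z z' (ζ + ζ')
    simp only [map_add, LinearMap.add_apply, hz, zero_add, add_zero] at h1
    rw [add_comm] at h1
    exact eq_neg_of_add_eq_zero_right h1
  have hT : ∀ z z' ζ ζ', b (B z ζ) (B z' ζ') = 0 := by
    intro z z' ζ ζ'
    -- Under `b` the only possibly nonzero pairings among these four vectors are the antidiagonal
    -- ones, all equal up to sign. Pairing a nontrivial relation in `ℂ³` with each vector therefore
    -- kills the common value.
    have hdep : ¬ LinearIndependent ℂ ![B z ζ, B z ζ', B z' ζ, B z' ζ'] := by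
      intro hli
      have := hli.fintype_card_le_finrank
      simp at this
    rw [Fintype.not_linearIndependent_iff] at hdep
    obtain ⟨k, hk, i, hi⟩ := hdep
    simp only [Fin.sum_univ_four, Matrix.cons_val] at hk
    have e0 := congrArg (fun v => b v (B z ζ)) hk
    have e1 := congrArg (fun v => b v (B z ζ')) hk
    have e2 := congrArg (fun v => b v (B z' ζ)) hk
    have e3 := congrArg (fun v => b v (B z' ζ')) hk
    simp only [map_add, map_smul, LinearMap.add_apply, LinearMap.smul_apply, h, hζ, hz, map_zero,
      LinearMap.zero_apply, smul_zero, zero_add, add_zero, hsymm (B z' ζ') (B z ζ),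
      hsymm (B z' ζ) (B z ζ'), hanti z z' ζ ζ', smul_neg, neg_eq_zero, smul_eq_zero]
      at e0 e1 e2 e3
    fin_cases i
    · exact e3.resolve_left hi
    · exact e2.resolve_left hi
    · exact e1.resolve_left hi
    · exact e0.resolve_left hi
  have h1 : ∀ z ζ q, b (B z ζ) q = 0 := by
    intro z ζ q
    ext i
    have := hspan (LinearMap.proj i ∘ₗ b (B z ζ)) (fun z' ζ' => by simp [hT])
    simpa using LinearMap.congr_fun this q
  have h2 : ∀ p q, b p q = 0 := by
    intro p q
    ext i
    have := hspan (LinearMap.proj i ∘ₗ b.flip q) (fun z' ζ' => by simp [h1])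
    simpa using LinearMap.congr_fun this p
  exact LinearMap.ext fun p => LinearMap.ext fun q => h2 p q

/-- If some `B z` is onto `ℂ³`, then so are all `B (z + t y)` with small `t`. -/
lemma bilin_eq_zero_of_range_eq_top
    (hnd : ∀ e, (∀ y, B y e = 0) → e = 0)
    (b : (Fin 3 → ℂ) →ₗ[ℂ] (Fin 3 → ℂ) →ₗ[ℂ] (Fin n → ℂ))
    (h : ∀ z ζ ζ', B z (b (B z ζ) (B z ζ')) = 0) (z : Fin n → ℂ)
    (hz : LinearMap.range (B z) = ⊤) : b = 0 := by
  have hb : ∀ z, LinearMap.range (B z) = ⊤ → ∀ p q, B z (b p q) = 0 := by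
    intro z hz p q
    obtain ⟨ζ, rfl⟩ := LinearMap.range_eq_top.1 hz p
    obtain ⟨ζ', rfl⟩ := LinearMap.range_eq_top.1 hz q
    exact h z ζ ζ'
  choose ζ hζ using fun i : Fin 3 => LinearMap.range_eq_top.1 hz (Pi.single i 1)
  suffices hy : ∀ y p q, B y (b p q) = 0 by
    refine LinearMap.ext fun p => LinearMap.ext fun q => hnd _ fun y => hy y p q
  intro y p q
  -- The `ζ i` are preimages of the standard basis under `B z`, so `D 0 = 1`. A nonzero `D t` keeps
  -- `B (z + t y)` onto.
  let D : ℂ → ℂ := fun t => (Matrix.of fun i j => B (z + t • y) (ζ i) j).det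
  have hDc : Continuous D := by
    refine Continuous.matrix_det ?_
    refine continuous_matrix fun i j => ?_
    simp only [map_add, map_smul, LinearMap.add_apply, LinearMap.smul_apply, Matrix.of_apply,
      Pi.add_apply, Pi.smul_apply]
    fun_prop
  have hD0 : D 0 ≠ 0 := by
    have : (Matrix.of fun i j => B (z + (0 : ℂ) • y) (ζ i) j) = (1 : Matrix (Fin 3) (Fin 3) ℂ) := by
      ext i j
      simp [hζ, Matrix.one_apply, Pi.single_apply, eq_comm]
    simp only [D, this, Matrix.det_one]
    exact one_ne_zero
  have hev : ∀ᶠ t in 𝓝 (0 : ℂ), D t ≠ 0 := hDc.continuousAt.eventually_ne hD0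
  obtain ⟨t, ht, ht0⟩ := ((hev.filter_mono nhdsWithin_le_nhds).and
    (self_mem_nhdsWithin : {t : ℂ | t ≠ 0} ∈ 𝓝[≠] (0 : ℂ))).exists
  have htop : LinearMap.range (B (z + t • y)) = ⊤ := by
    have hli : LinearIndependent ℂ (fun i => B (z + t • y) (ζ i)) := by
      have := Matrix.linearIndependent_rows_of_det_ne_zero ht
      exact this
    have hs := hli.span_eq_top_of_card_eq_finrank (by simp)
    rw [eq_top_iff, ← hs, Submodule.span_le]
    rintro _ ⟨i, rfl⟩
    exact ⟨ζ i, rfl⟩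
  have h1 := hb _ htop p q
  rw [map_add, map_smul, LinearMap.add_apply, LinearMap.smul_apply, hb z hz p q, zero_add] at h1
  exact (smul_eq_zero.1 h1).resolve_left ht0

/-- If no `B z` is onto `ℂ³` and the values `B y e` fill exactly the line through `w₀`, then `B`
maps `V × U` into that line for some hyperplane `U`. -/
lemma exists_hyperplane_of_line
    (hspan : ∀ c : (Fin 3 → ℂ) →ₗ[ℂ] ℂ, (∀ z ζ, c (B z ζ) = 0) → c = 0)
    (hrank : ∀ z, LinearMap.range (B z) ≠ ⊤) {e y₀ : Fin n → ℂ} {w₀ : Fin 3 → ℂ}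
    (hw₀ : w₀ ≠ 0) (hy₀ : B y₀ e = w₀) (hline : ∀ y, ∃ c : ℂ, B y e = c • w₀) :
    ∃ ψ : (Fin n → ℂ) →ₗ[ℂ] ℂ, ψ ≠ 0 ∧ ψ e = 0 ∧
      ∀ y u, ψ u = 0 → ∃ c : ℂ, B y u = c • w₀ := by
  obtain ⟨A, hA⟩ := SeparatingDual.exists_continuousLinearEquiv_apply_eq (R := ℂ) hw₀
    (show (Pi.single 0 1 : Fin 3 → ℂ) ≠ 0 by simp)
  let μ : Fin 3 → (Fin 3 → ℂ) →ₗ[ℂ] ℂ := fun i => LinearMap.proj i ∘ₗ A.toLinearEquiv.toLinearMap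
  have hμ : ∀ i x, μ i x = A x i := fun i x => rfl
  have hmem : ∀ x, A x 1 = 0 → A x 2 = 0 → x = (A x 0) • w₀ := by
    intro x h1 h2
    apply A.injective
    rw [map_smul, hA]
    ext i
    fin_cases i <;> simp [h1, h2]
  let G : Fin 3 → (Fin n → ℂ) →ₗ[ℂ] (Fin n → ℂ) →ₗ[ℂ] ℂ := fun i => B.compr₂ (μ i)
  have hG : ∀ i z ζ, G i z ζ = A (B z ζ) i := fun i z ζ => rfl
  -- Here the range of `B z` contains `w₀` but is not `ℂ³`. A nonzero functional killing it has no
  -- zeroth coefficient in the coordinates `A`, so it relates `G 1 z` and `G 2 z` linearly.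
  have hNm : ∀ z, G 0 z e ≠ 0 → ∀ ζ ζ', G 1 z ζ * G 2 z ζ' = G 1 z ζ' * G 2 z ζ := by
    intro z hz ζ ζ'
    obtain ⟨c, hc, hker⟩ := Submodule.exists_le_ker_of_lt_top _ (lt_top_iff_ne_top.2 (hrank z))
    let c' : Fin 3 → ℂ := fun i => c (A.symm (Pi.single i 1))
    have hcx : ∀ x, c x = c' 0 * A x 0 + c' 1 * A x 1 + c' 2 * A x 2 := by
      intro x
      have hx : x = A x 0 • A.symm (Pi.single 0 1) + A x 1 • A.symm (Pi.single 1 1) +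
          A x 2 • A.symm (Pi.single 2 1) := by
        apply A.injective
        ext i
        fin_cases i <;> simp
      conv_lhs => rw [hx]
      simp only [map_add, map_smul, smul_eq_mul, c']
      ring
    have hcz : ∀ ζ, c (B z ζ) = 0 := fun ζ => hker ⟨ζ, rfl⟩
    obtain ⟨d, hd⟩ := hline z
    have hAe : A (B z e) 1 = 0 ∧ A (B z e) 2 = 0 := by simp [hd, hA]
    have h0 : c' 0 = 0 := by
      have := hcz e
      rw [hcx, hAe.1, hAe.2] at this
      simpa [← hG, hz] using this
    have h12 : c' 1 ≠ 0 ∨ c' 2 ≠ 0 := by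
      by_contra! hh
      exact hc (LinearMap.ext fun x => by simp [hcx, h0, hh.1, hh.2])
    have k1 := hcz ζ
    have k2 := hcz ζ'
    rw [hcx, h0] at k1 k2
    simp only [hG]
    rcases h12 with h | h
    · apply mul_left_cancel₀ h
      linear_combination A (B z ζ') 2 * k1 - A (B z ζ) 2 * k2
    · apply mul_left_cancel₀ h
      linear_combination A (B z ζ) 1 * k2 - A (B z ζ') 1 * k1
  have hy₀0 : G 0 y₀ e = 1 := by simp [hG, hy₀, hA]
  have hprop : ∀ z ζ ζ', G 1 z ζ * G 2 z ζ' = G 1 z ζ' * G 2 z ζ := by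
    intro z ζ ζ'
    by_cases hz : G 0 z e = 0
    -- Along `z + t y₀` the relation is a quadratic polynomial in `t`. Its value at `0` is recovered
    -- by Lagrange interpolation from `1`, `-1` and `2`.
    · have hN : ∀ t : ℂ, t ≠ 0 → G 0 (z + t • y₀) e ≠ 0 := by
        intro t ht
        simp [hz, hy₀0, ht]
      have m1 := hNm _ (hN 1 one_ne_zero) ζ ζ'
      have m2 := hNm _ (hN (-1) (by simp)) ζ ζ'
      have m3 := hNm _ (hN 2 two_ne_zero) ζ ζ'
      simp only [map_add, map_smul, LinearMap.add_apply, LinearMap.smul_apply, smul_eq_mul]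
        at m1 m2 m3
      linear_combination m1 + (1 / 3 : ℂ) * m2 - (1 / 3 : ℂ) * m3
    · exact hNm z hz ζ ζ'
  have hind : ∀ c₁ c₂ : ℂ, (∀ z ζ, c₁ * G 1 z ζ + c₂ * G 2 z ζ = 0) → c₁ = 0 ∧ c₂ = 0 := by
    intro c₁ c₂ h
    have h1 := hspan (c₁ • μ 1 + c₂ • μ 2) (fun z ζ => by simpa [hμ, hG] using h z ζ)
    have k1 := LinearMap.congr_fun h1 (A.symm (Pi.single 1 1))
    have k2 := LinearMap.congr_fun h1 (A.symm (Pi.single 2 1))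
    simp [hμ] at k1 k2
    exact ⟨k1, k2⟩
  obtain ⟨ψ, hψ, hker⟩ := exists_common_ker_of_proportional (G 1) (G 2) hprop hind
  refine ⟨ψ, hψ, ?_, fun y u hu => ⟨_, hmem _ (hker y u hu).1 (hker y u hu).2⟩⟩
  -- If `ψ e ≠ 0`, then `e` and the kernel of `ψ` span the space, and `G 1` vanishes on both.
  by_contra he
  have hG1 : ∀ z, G 1 z e = 0 := by
    intro z
    obtain ⟨d, hd⟩ := hline z
    simp [hG, hd, hA]
  have : ∀ z ζ, G 1 z ζ = 0 := by
    intro z ζ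
    have h1 := (hker z (ζ - (ψ ζ / ψ e) • e) (by simp [he])).1
    simpa [hG1] using h1
  exact one_ne_zero (hind 1 0 (by simp [this])).1

/-- The two cases of a hyperplane `U` with `B (V × U)` contained in a line: the line cannot be
real, and `B` vanishes on `Ū × U`. -/
lemma vanish_of_hyperplane
    (hstar : ∀ z ζ, star (B z ζ) = B (star ζ) (star z))
    (hspan : ∀ c : (Fin 3 → ℂ) →ₗ[ℂ] ℂ, (∀ z ζ, c (B z ζ) = 0) → c = 0)
    {w₀ : Fin 3 → ℂ} {ψ : (Fin n → ℂ) →ₗ[ℂ] ℂ} (hψ : ψ ≠ 0)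
    (hU : ∀ y u, ψ u = 0 → ∃ c : ℂ, B y u = c • w₀)
    (z u : Fin n → ℂ) (hz : ψ (star z) = 0) (hu : ψ u = 0) : B z u = 0 := by
  by_contra hne
  obtain ⟨c₁, h₁⟩ := hU z u hu
  obtain ⟨c₂, h₂⟩ := hU (star u) (star z) hz
  have hc₁ : c₁ ≠ 0 := by rintro rfl; simp [h₁] at hne
  -- A nonzero value on `Ū × U` and its conjugate both lie on the line, so the line is stable under
  -- conjugation. Then `B (Ū × V)` lies in it as well, and all values of `B` lie in the span of `w₀`
  -- and `B (star x) x`, contrary to `hspan`.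
  have hw : star w₀ = ((star c₁)⁻¹ * c₂) • w₀ := by
    have h3 := hstar z u
    rw [h₁, h₂, star_smul] at h3
    rw [mul_smul, ← h3, smul_smul, inv_mul_cancel₀ (star_ne_zero.2 hc₁), one_smul]
  have hU' : ∀ y ζ, ψ (star y) = 0 → ∃ c : ℂ, B y ζ = c • w₀ := by
    intro y ζ hy
    obtain ⟨c, hc⟩ := hU (star ζ) (star y) hy
    refine ⟨star c * ((star c₁)⁻¹ * c₂), ?_⟩
    rw [mul_smul, ← hw, ← star_smul, ← hc, hstar, star_star, star_star]
  obtain ⟨x, hx⟩ : ∃ x, ψ x = 1 := by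
    obtain ⟨x, hx⟩ : ∃ x, ψ x ≠ 0 := by
      by_contra! h
      exact hψ (LinearMap.ext h)
    exact ⟨(ψ x)⁻¹ • x, by simp [hx]⟩
  have hlt : Submodule.span ℂ (Set.range ![w₀, B (star x) x]) < ⊤ := by
    rw [lt_top_iff_ne_top]
    intro h
    have h1 := finrank_range_le_card (R := ℂ) ![w₀, B (star x) x]
    rw [Set.finrank, h, finrank_top] at h1
    simp at h1
  obtain ⟨c, hc, hker⟩ := Submodule.exists_le_ker_of_lt_top _ hlt
  have k1 : c w₀ = 0 := hker (Submodule.subset_span ⟨0, rfl⟩)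
  have k2 : c (B (star x) x) = 0 := hker (Submodule.subset_span ⟨1, rfl⟩)
  refine hc (hspan c fun y ζ => ?_)
  obtain ⟨d₁, e₁⟩ := hU y (ζ - ψ ζ • x) (by simp [hx])
  obtain ⟨d₂, e₂⟩ := hU' (y - star (ψ (star y)) • star x) x (by simp [hx])
  rw [map_sub, sub_eq_iff_eq_add] at e₁
  rw [map_sub, LinearMap.sub_apply, sub_eq_iff_eq_add] at e₂
  simp only [map_smul, LinearMap.smul_apply] at e₁ e₂
  rw [e₁, e₂]
  simp [k1, k2]

/-- A symmetric bilinear map `b : ℂ³ × ℂ³ → ℂⁿ` with `B z (b q q) = 0` for all values `q = B z ζ`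
vanishes, if `B` is a nondegenerate Hermitian form with spanning values. -/
theorem symm_bilin_eq_zero
    (hstar : ∀ z ζ, star (B z ζ) = B (star ζ) (star z))
    (hnd : ∀ e, (∀ y, B y e = 0) → e = 0)
    (hspan : ∀ c : (Fin 3 → ℂ) →ₗ[ℂ] ℂ, (∀ z ζ, c (B z ζ) = 0) → c = 0)
    (b : (Fin 3 → ℂ) →ₗ[ℂ] (Fin 3 → ℂ) →ₗ[ℂ] (Fin n → ℂ)) (hsymm : ∀ p q, b p q = b q p)
    (h : ∀ z ζ, B z (b (B z ζ) (B z ζ)) = 0) : b = 0 := by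
  have hpol : ∀ z ζ ζ', B z (b (B z ζ) (B z ζ')) = 0 := by
    intro z ζ ζ'
    have h1 := h z (ζ + ζ')
    simp only [map_add, LinearMap.add_apply, h, hsymm (B z ζ') (B z ζ), zero_add, add_zero,
      ← two_smul ℂ] at h1
    simpa using h1
  by_cases hrank : ∃ z, LinearMap.range (B z) = ⊤
  · obtain ⟨z, hz⟩ := hrank
    exact bilin_eq_zero_of_range_eq_top B hnd b hpol z hz
  push Not at hrank
  refine symm_bilin_eq_zero_of_apply_self B hspan b hsymm fun z ζ => ?_
  by_contra he
  set p := B z ζ with hp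
  set e := b p p with hedef
  have hze : B z e = 0 := h z ζ
  -- The part of the cubic identity `h` that is linear in `y` reads `B y e = -2 B z (b p (B y ζ))`.
  -- It is isolated by subtracting the values at `z ± y` and removing the cubic part by `h y ζ`.
  have hye : ∀ y, B y e ∈ LinearMap.range (B z) := by
    intro y
    have h1 := h (z + y) ζ
    have h2 := h (z - y) ζ
    have h3 := h y ζ
    refine ⟨-((2 : ℂ) • b p (B y ζ)), ?_⟩
    simp only [map_add, map_sub, LinearMap.add_apply, LinearMap.sub_apply, ← hp, ← hedef,
      hsymm (B y ζ) p] at h1 h2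
    rw [hze] at h1 h2
    rw [h3] at h1 h2
    have h4 := congrArg₂ (· - ·) h1 h2
    simp only [sub_self] at h4
    rw [map_neg, map_smul, two_smul, neg_eq_iff_add_eq_zero]
    have h5 : (2 : ℂ) • (B z (b p (B y ζ)) + B z (b p (B y ζ)) + B y e) = 0 := by
      rw [← h4]; module
    exact (smul_eq_zero.1 h5).resolve_left two_ne_zero
  -- If `p = B y e`, then `h y e` reads `B y (b p p) = 0`, that is `p = 0`, whence `e = 0`.
  have hpe : ∀ y, B y e ≠ p := by
    intro y hy
    have h1 := h y e
    rw [hy] at h1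
    have : p = 0 := by rw [← hy]; exact h1
    exact he (by rw [hedef, this]; simp)
  obtain ⟨y₀, hy₀⟩ : ∃ y, B y e ≠ 0 := by
    by_contra! hh
    exact he (hnd e hh)
  have hlt : LinearMap.range (B.flip e) < LinearMap.range (B z) := by
    refine lt_of_le_of_ne ?_ ?_
    · rintro _ ⟨y, rfl⟩
      exact hye y
    · intro heq
      have : p ∈ LinearMap.range (B.flip e) := heq ▸ ⟨ζ, rfl⟩
      obtain ⟨y, hy⟩ := this
      exact hpe y hy
  have hfin : Module.finrank ℂ (LinearMap.range (B.flip e)) ≤ 1 := by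
    have h1 := Submodule.finrank_lt_finrank_of_lt hlt
    have h2 := Submodule.finrank_lt (hrank z)
    simp at h2
    omega
  obtain ⟨v, hv⟩ := finrank_le_one_iff.1 hfin
  have hline : ∀ y, ∃ c : ℂ, B y e = c • B y₀ e := by
    intro y
    obtain ⟨c₀, hc₀⟩ := hv ⟨B y₀ e, ⟨y₀, rfl⟩⟩
    obtain ⟨c, hc⟩ := hv ⟨B y e, ⟨y, rfl⟩⟩
    have hc₀' : c₀ • (v : Fin 3 → ℂ) = B y₀ e := congrArg Subtype.val hc₀
    have hc' : c • (v : Fin 3 → ℂ) = B y e := congrArg Subtype.val hc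
    have : c₀ ≠ 0 := by rintro rfl; exact hy₀ (by rw [← hc₀', zero_smul])
    refine ⟨c * c₀⁻¹, ?_⟩
    rw [← hc', ← hc₀', smul_smul, mul_assoc, inv_mul_cancel₀ this, mul_one]
  obtain ⟨ψ, hψ, hψe, hU⟩ := exists_hyperplane_of_line B hspan hrank hy₀ rfl hline
  have hvan := vanish_of_hyperplane B hstar hspan hψ hU
  -- Otherwise `z` and `Ū` span the space, while `B · e` vanishes at `z` and on `Ū`, contrary to
  -- nondegeneracy.
  have hzU : ψ (star z) = 0 := by
    by_contra hz
    refine he (hnd e fun y => ?_)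
    have h1 := hvan (y - star (ψ (star y) / ψ (star z)) • z) e (by simp [hz]) hψe
    simpa [hze] using h1
  have hLz : ∀ ζ, ∃ c : ℂ, B z ζ = c • star (B y₀ e) := by
    intro ζ
    obtain ⟨c, hc⟩ := hU (star ζ) (star z) hzU
    refine ⟨star c, ?_⟩
    rw [← star_smul, ← hc, hstar, star_star, star_star]
  -- The range of `B z` lies in one line and contains `B y₀ e ≠ 0`. So `p` is a multiple of `B y₀
  -- e`, which `hpe` forbids.
  obtain ⟨α, hα⟩ := hLz ζ
  obtain ⟨ζ', hζ'⟩ := hye y₀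
  obtain ⟨β, hβ⟩ := hLz ζ'
  rw [hζ'] at hβ
  have hβ0 : β ≠ 0 := by rintro rfl; exact hy₀ (by rw [hβ, zero_smul])
  refine hpe ((α * β⁻¹) • y₀) ?_
  rw [map_smul, LinearMap.smul_apply, hβ, hp, hα, smul_smul, mul_assoc, inv_mul_cancel₀ hβ0,
    mul_one]

end BilinearMap

/-! ### Complexified tangency and fields of weight at least three -/

section Calculus

open Complex Filter

variable {n : ℕ} (B : (Fin n → ℂ) →ₗ[ℂ] (Fin n → ℂ) →ₗ[ℂ] (Fin 3 → ℂ))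

lemma Differentiable.bilin {E : Type*} [NormedAddCommGroup E] [NormedSpace ℂ E]
    {F G : E → Fin n → ℂ} (hF : Differentiable ℂ F) (hG : Differentiable ℂ G) :
    Differentiable ℂ fun x => B (F x) (G x) := by
  let C : (Fin n → ℂ) →L[ℂ] (Fin n → ℂ) →L[ℂ] (Fin 3 → ℂ) :=
    LinearMap.toContinuousLinearMap (LinearMap.toContinuousLinearMap.toLinearMap ∘ₗ B)
  exact (C.differentiable.comp hF).clm_apply hG

/-- The identity expressing that the field `(f, g)`, with conjugate `(f', g')`, is tangent to the
complexification of the quadric `Im w = B z z̄`. -/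
def ComplexTangent (f : (Fin n → ℂ) → (Fin 3 → ℂ) → Fin n → ℂ)
    (g : (Fin n → ℂ) → (Fin 3 → ℂ) → Fin 3 → ℂ)
    (f' : (Fin n → ℂ) → (Fin 3 → ℂ) → Fin n → ℂ)
    (g' : (Fin n → ℂ) → (Fin 3 → ℂ) → Fin 3 → ℂ) : Prop :=
  ∀ z ζ w, g z w - g' ζ (w - (2 * I) • B z ζ) =
    (2 * I) • (B (f z w) ζ + B z (f' ζ (w - (2 * I) • B z ζ)))

variable {B}
variable {f : (Fin n → ℂ) → (Fin 3 → ℂ) → Fin n → ℂ}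
  {g : (Fin n → ℂ) → (Fin 3 → ℂ) → Fin 3 → ℂ}
  {f' : (Fin n → ℂ) → (Fin 3 → ℂ) → Fin n → ℂ}
  {g' : (Fin n → ℂ) → (Fin 3 → ℂ) → Fin 3 → ℂ}

/-- Tangency at the points of the quadric extends to the complexified quadric. -/
lemma complexTangent_of_real (hstar : ∀ z ζ, star (B z ζ) = B (star ζ) (star z))
    (hf : Differentiable ℂ fun p : (Fin n → ℂ) × (Fin 3 → ℂ) => f p.1 p.2)
    (hg : Differentiable ℂ fun p : (Fin n → ℂ) × (Fin 3 → ℂ) => g p.1 p.2)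
    (hf' : Differentiable ℂ fun p : (Fin n → ℂ) × (Fin 3 → ℂ) => f' p.1 p.2)
    (hg' : Differentiable ℂ fun p : (Fin n → ℂ) × (Fin 3 → ℂ) => g' p.1 p.2)
    (h : ∀ z w, w - star w = (2 * I) • B z (star z) → g z w - g' (star z) (star w) =
      (2 * I) • (B (f z w) (star z) + B z (f' (star z) (star w)))) :
    ComplexTangent B f g f' g' := by
  intro z ζ w
  set u := w - I • B z ζ with hu
  -- A complex line through the target point: for real `τ`, `Y = star Z` and `U` is real, so the
  -- hypothesis `h` applies. At `τ = I` it reaches `(z, ζ, u)`, and the identity theorem in one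
  -- variable connects the two.
  let Z : ℂ → Fin n → ℂ := fun τ => (1 / 2 : ℂ) • (z + star ζ) + τ • (-I / 2) • (z - star ζ)
  let Y : ℂ → Fin n → ℂ := fun τ => (1 / 2 : ℂ) • (star z + ζ) + τ • (I / 2) • (star z - ζ)
  let U : ℂ → Fin 3 → ℂ := fun τ => (1 / 2 : ℂ) • (u + star u) + τ • (-I / 2) • (u - star u)
  have hZ : Differentiable ℂ Z := by fun_prop
  have hY : Differentiable ℂ Y := by fun_prop
  have hU : Differentiable ℂ U := by fun_prop
  let P : ℂ → Fin 3 → ℂ := fun τ => U τ + I • B (Z τ) (Y τ)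
  let M : ℂ → Fin 3 → ℂ := fun τ => U τ - I • B (Z τ) (Y τ)
  have hB : Differentiable ℂ fun τ => B (Z τ) (Y τ) := hZ.bilin B hY
  have hP : Differentiable ℂ P := hU.add (hB.const_smul I)
  have hM : Differentiable ℂ M := hU.sub (hB.const_smul I)
  let Φ : ℂ → Fin 3 → ℂ := fun τ => g (Z τ) (P τ) - g' (Y τ) (M τ) -
    (2 * I) • (B (f (Z τ) (P τ)) (Y τ) + B (Z τ) (f' (Y τ) (M τ)))
  have hΦ : Differentiable ℂ Φ := by
    have k1 : Differentiable ℂ fun τ => f (Z τ) (P τ) := hf.comp (hZ.prodMk hP)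
    have k2 : Differentiable ℂ fun τ => f' (Y τ) (M τ) := hf'.comp (hY.prodMk hM)
    have k3 : Differentiable ℂ fun τ => g (Z τ) (P τ) := hg.comp (hZ.prodMk hP)
    have k4 : Differentiable ℂ fun τ => g' (Y τ) (M τ) := hg'.comp (hY.prodMk hM)
    have k5 := k1.bilin B hY
    have k6 := hZ.bilin B k2
    exact (k3.sub k4).sub ((k5.add k6).const_smul (2 * I))
  have hreal : ∀ t : ℝ, Φ t = 0 := by
    intro t
    have e1 : Y t = star (Z t) := by
      ext i
      simp [Y, Z]
    have e2 : star (U t) = U t := by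
      ext i
      simp [U]
      ring
    have e3 : star (B (Z t) (Y t)) = B (Z t) (Y t) := by
      rw [hstar, e1, star_star]
    have e4 : star (P t) = M t := by
      simp only [P, M, star_add, star_smul, e2, e3]
      simp [sub_eq_add_neg]
    have e5 := h (Z t) (P t) (by
      rw [e4, ← e1]
      simp only [P, M]
      module)
    simp only [Φ]
    rw [e1, ← e4, e5, sub_self]
  have hzero : Φ = 0 := by
    have ha : AnalyticOnNhd ℂ Φ Set.univ := fun τ _ => hΦ.analyticAt τ
    refine ha.eq_of_frequently_eq (z₀ := 0) (fun τ _ => analyticAt_const) ?_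
    have htend : Tendsto (fun t : ℝ => (t : ℂ)) (𝓝[≠] 0) (𝓝[≠] 0) := by
      refine tendsto_nhdsWithin_iff.2 ⟨?_, ?_⟩
      · have := (Complex.continuous_ofReal.tendsto 0).mono_left (nhdsWithin_le_nhds (s := {0}ᶜ))
        simpa using this
      · filter_upwards [self_mem_nhdsWithin] with t ht
        simpa using ht
    exact htend.frequently (Frequently.of_forall fun t => by simp [hreal])
  have hI := congrFun hzero I
  have eZ : Z I = z := by
    ext i
    simp only [Z, Pi.add_apply, Pi.smul_apply, Pi.sub_apply, smul_eq_mul]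
    linear_combination (-(z i) / 2 + (star ζ) i / 2) * I_mul_I
  have eY : Y I = ζ := by
    ext i
    simp only [Y, Pi.add_apply, Pi.smul_apply, Pi.sub_apply, smul_eq_mul]
    linear_combination ((star z) i / 2 - ζ i / 2) * I_mul_I
  have eU : U I = u := by
    ext i
    simp only [U, Pi.add_apply, Pi.smul_apply, Pi.sub_apply, smul_eq_mul]
    linear_combination (-(u i) / 2 + (star u) i / 2) * I_mul_I
  have eP : P I = w := by simp [P, eZ, eY, eU, hu]
  have eM : M I = w - (2 * I) • B z ζ := by
    simp only [M, eZ, eY, eU, hu]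
    module
  simp only [Φ, eZ, eY, eP, eM, Pi.zero_apply] at hI
  exact sub_eq_zero.1 hI

/-- The complexified Heisenberg translation in the conjugate variable. -/
lemma ComplexTangent.translate (h : ComplexTangent B f g f' g') (β : Fin n → ℂ) :
    ComplexTangent B (fun z w => f z (w + (2 * I) • B z β))
      (fun z w => g z (w + (2 * I) • B z β) - (2 * I) • B (f z (w + (2 * I) • B z β)) β)
      (fun ζ w => f' (ζ + β) w) (fun ζ w => g' (ζ + β) w) := by
  intro z ζ w
  have h1 := h z (ζ + β) (w + (2 * I) • B z β)
  have e : w + (2 * I) • B z β - (2 * I) • B z (ζ + β) = w - (2 * I) • B z ζ := by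
    rw [map_add]; module
  rw [e, map_add] at h1
  rw [sub_right_comm, h1]
  module

/-- Replacing `(z, ζ)` by `(s z, ζ / s)` keeps `B z ζ` fixed. After eliminating `g` and `g'` by the
cases `ζ = 0` and `z = 0`, all other terms of the identity divided by `s` converge. The limit is
linear in `ζ` because each approximant is, although its formula is not visibly so. -/
lemma ComplexTangent.tendsto (h : ComplexTangent B f g f' g')
    (hf' : Continuous fun p : (Fin n → ℂ) × (Fin 3 → ℂ) => f' p.1 p.2)
    (z ζ : Fin n → ℂ) (w : Fin 3 → ℂ) :
    Tendsto (fun s : ℕ => ((s : ℂ) ^ 2)⁻¹ • B (f ((s : ℂ) • z) w) ζ) atTop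
      (𝓝 (B z (f' 0 w) - B z (f' 0 (w - (2 * I) • B z ζ)))) := by
  set ω := w - (2 * I) • B z ζ with hω
  have h1 : ∀ z w, g z w = g' 0 w + (2 * I) • B z (f' 0 w) := by
    intro z w
    have := h z 0 w
    simp only [map_zero, smul_zero, sub_zero, zero_add] at this
    rw [← this]; abel
  have h2 : ∀ ζ w, g' ζ w = g' 0 w - (2 * I) • B (f 0 w) ζ := by
    intro ζ w
    have := h 0 ζ w
    simp only [map_zero, LinearMap.zero_apply, smul_zero, sub_zero, add_zero] at this
    rw [← this, h1 0 w]
    simp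
  have h3 : ∀ᶠ s : ℕ in atTop, B z (f' 0 w) - B z (f' ((s : ℂ)⁻¹ • ζ) ω) +
      (s : ℂ)⁻¹ • ((2 * I)⁻¹ • (g' 0 w - g' 0 ω)) + ((s : ℂ)⁻¹) ^ 2 • B (f 0 ω) ζ =
      ((s : ℂ) ^ 2)⁻¹ • B (f ((s : ℂ) • z) w) ζ := by
    filter_upwards [eventually_gt_atTop 0] with s hs
    have hs' : (s : ℂ) ≠ 0 := by exact_mod_cast hs.ne'
    have h4 := h ((s : ℂ) • z) ((s : ℂ)⁻¹ • ζ) w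
    simp only [map_smul, LinearMap.smul_apply, inv_smul_smul₀ hs'] at h4
    rw [← hω, h1, h2 _ ω] at h4
    simp only [map_smul, LinearMap.smul_apply] at h4
    ext i
    have h5 := congrFun h4 i
    simp only [Pi.add_apply, Pi.sub_apply, Pi.smul_apply, smul_eq_mul] at h5 ⊢
    have hI := I_ne_zero
    field_simp
    field_simp at h5
    linear_combination h5
  refine Tendsto.congr' h3 ?_
  have hinv : Tendsto (fun s : ℕ => (s : ℂ)⁻¹) atTop (𝓝 0) :=
    tendsto_inv_atTop_nhds_zero_nat
  have hB : Continuous (B z) := LinearMap.continuous_of_finiteDimensional _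
  have t1 : Tendsto (fun s : ℕ => B z (f' ((s : ℂ)⁻¹ • ζ) ω)) atTop (𝓝 (B z (f' 0 ω))) := by
    have k : Continuous fun c : ℂ => B z (f' (c • ζ) ω) :=
      hB.comp (hf'.comp (by fun_prop : Continuous fun c : ℂ => (c • ζ, ω)))
    simpa [Function.comp_def] using (k.tendsto 0).comp hinv
  have t2 := hinv.smul_const ((2 * I)⁻¹ • (g' 0 w - g' 0 ω))
  have t3 := (hinv.pow 2).smul_const (B (f 0 ω) ζ)
  simpa using ((t1.const_sub (B z (f' 0 w))).add t2).add t3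

/-- Along the directions `B z ζ` the coefficient `f' 0` is affine modulo the kernel of `B z`. -/
lemma ComplexTangent.affine_along (h : ComplexTangent B f g f' g')
    (hf' : Continuous fun p : (Fin n → ℂ) × (Fin 3 → ℂ) => f' p.1 p.2)
    (z ζ : Fin n → ℂ) (w : Fin 3 → ℂ) :
    ∃ k, ∀ t : ℂ, B z (f' 0 (w + t • B z ζ)) = B z (f' 0 w) + t • k := by
  have h1 : ∀ t : ℂ, B z (f' 0 w) - B z (f' 0 (w - (2 * I) • B z (t • ζ))) =
      t • (B z (f' 0 w) - B z (f' 0 (w - (2 * I) • B z ζ))) := by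
    intro t
    refine tendsto_nhds_unique (h.tendsto hf' z (t • ζ) w) ?_
    have := (h.tendsto hf' z ζ w).const_smul t
    refine this.congr fun s => ?_
    rw [map_smul, smul_comm]
  refine ⟨(2 * I)⁻¹ • (B z (f' 0 w) - B z (f' 0 (w - (2 * I) • B z ζ))), fun t => ?_⟩
  have h2 := h1 (-(t * (2 * I)⁻¹))
  have e : w - (2 * I) • B z (-(t * (2 * I)⁻¹) • ζ) = w + t • B z ζ := by
    rw [map_smul, smul_smul]
    have : (2 * I) * -(t * (2 * I)⁻¹) = -t := by
      have := I_ne_zero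
      field_simp
    rw [this, neg_smul, sub_neg_eq_add]
  rw [e] at h2
  rw [smul_smul, ← sub_eq_iff_eq_add', ← neg_inj, neg_sub, h2, neg_smul]

/-- A `C²` map that is affine along `q` modulo the kernel of `L` has second derivative along `q`
in the kernel of `L`. -/
lemma fderiv_fderiv_of_affine_along {E F G : Type*} [NormedAddCommGroup E] [NormedSpace ℂ E]
    [NormedAddCommGroup F] [NormedSpace ℂ F] [NormedAddCommGroup G] [NormedSpace ℂ G]
    {a : E → F} (ha : ContDiff ℂ 2 a) (L : F →L[ℂ] G) (w q : E) {c k : G}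
    (h : ∀ t : ℂ, L (a (w + t • q)) = c + t • k) : L (fderiv ℂ (fderiv ℂ a) w q q) = 0 := by
  have hline : ∀ t : ℂ, HasDerivAt (fun t : ℂ => w + t • q) q t := by
    intro t
    simpa using ((hasDerivAt_id t).smul_const q).const_add w
  have ha1 : Differentiable ℂ a := ha.differentiable (by norm_num)
  have ha2 : Differentiable ℂ (fderiv ℂ a) :=
    (ha.fderiv_right (m := 1) (by norm_num)).differentiable (by norm_num)
  have h1 : ∀ t : ℂ, L (fderiv ℂ a (w + t • q) q) = k := by
    intro t
    have d1 : HasDerivAt (fun t : ℂ => L (a (w + t • q))) (L (fderiv ℂ a (w + t • q) q)) t :=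
      L.hasFDerivAt.comp_hasDerivAt t
        ((ha1 (w + t • q)).hasFDerivAt.comp_hasDerivAt t (hline t))
    have d2 : HasDerivAt (fun t : ℂ => L (a (w + t • q))) k t := by
      simp only [h]
      simpa using ((hasDerivAt_id t).smul_const k).const_add c
    exact d1.unique d2
  have d1 : HasDerivAt (fun t : ℂ => L (fderiv ℂ a (w + t • q) q))
      (L (fderiv ℂ (fderiv ℂ a) (w + (0 : ℂ) • q) q q)) 0 :=
    L.hasFDerivAt.comp_hasDerivAt (0 : ℂ)
      (((ContinuousLinearMap.apply ℂ F q).hasFDerivAt.comp_hasDerivAt (0 : ℂ)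
        ((ha2 (w + (0 : ℂ) • q)).hasFDerivAt.comp_hasDerivAt (0 : ℂ) (hline 0))))
  simp only [h1, zero_smul, add_zero] at d1
  exact d1.unique (hasDerivAt_const _ _)

lemma eq_affine_of_fderiv_fderiv_eq_zero {E F : Type*} [NormedAddCommGroup E] [NormedSpace ℂ E]
    [NormedAddCommGroup F] [NormedSpace ℂ F] {a : E → F} (ha : ContDiff ℂ 2 a)
    (h : ∀ w, fderiv ℂ (fderiv ℂ a) w = 0) : ∃ T : E →L[ℂ] F, ∀ w, a w = a 0 + T w := by
  have ha1 : Differentiable ℂ a := ha.differentiable (by norm_num)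
  have ha2 : Differentiable ℂ (fderiv ℂ a) :=
    (ha.fderiv_right (m := 1) (by norm_num)).differentiable (by norm_num)
  refine ⟨fderiv ℂ a 0, fun w => ?_⟩
  have hc : ∀ w, fderiv ℂ a w = fderiv ℂ a 0 := fun w => is_const_of_fderiv_eq_zero ha2 h w 0
  have hd : Differentiable ℂ fun w => a w - fderiv ℂ a 0 w :=
    ha1.sub (fderiv ℂ a 0).differentiable
  have := is_const_of_fderiv_eq_zero hd (fun w => by
    rw [fderiv_fun_sub (ha1 w) (fderiv ℂ a 0).differentiableAt, ContinuousLinearMap.fderiv, hc,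
      sub_self]) w 0
  simp only [map_zero, sub_zero] at this
  rw [← this]; abel

/-- In codimension three the component `f'` of a tangent field is affine in `w`. -/
lemma ComplexTangent.affine (h : ComplexTangent B f g f' g')
    (hstar : ∀ z ζ, star (B z ζ) = B (star ζ) (star z))
    (hnd : ∀ e, (∀ y, B y e = 0) → e = 0)
    (hspan : ∀ c : (Fin 3 → ℂ) →ₗ[ℂ] ℂ, (∀ z ζ, c (B z ζ) = 0) → c = 0)
    (hf' : ContDiff ℂ 2 fun p : (Fin n → ℂ) × (Fin 3 → ℂ) => f' p.1 p.2) (β : Fin n → ℂ) :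
    ∃ T : (Fin 3 → ℂ) →L[ℂ] (Fin n → ℂ), ∀ w, f' β w = f' β 0 + T w := by
  have hβ : ContDiff ℂ 2 (f' β) :=
    hf'.comp (contDiff_const.prodMk contDiff_id : ContDiff ℂ 2 fun w : Fin 3 → ℂ => (β, w))
  refine eq_affine_of_fderiv_fderiv_eq_zero hβ fun w => ?_
  let b : (Fin 3 → ℂ) →ₗ[ℂ] (Fin 3 → ℂ) →ₗ[ℂ] (Fin n → ℂ) :=
    LinearMap.mk₂ ℂ (fun p q => fderiv ℂ (fderiv ℂ (f' β)) w p q)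
      (by simp) (by simp) (by simp) (by simp)
  have hb : b = 0 := by
    refine symm_bilin_eq_zero B hstar hnd hspan b (fun p q => ?_) fun z ζ => ?_
    · exact hβ.contDiffAt.isSymmSndFDerivAt (by simp) p q
    -- Translation moves the point `β` to the origin, where `affine_along` gives information.
    · have h1 := h.translate β
      obtain ⟨k, hk⟩ := h1.affine_along
        (hf'.continuous.comp (by fun_prop :
          Continuous fun p : (Fin n → ℂ) × (Fin 3 → ℂ) => (p.1 + β, p.2))) z ζ w
      simp only [zero_add] at hk
      exact fderiv_fderiv_of_affine_along hβ (LinearMap.toContinuousLinearMap (B z)) w (B z ζ) hk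
  ext1 p
  ext1 q
  exact LinearMap.congr_fun (LinearMap.congr_fun hb p) q

lemma eq_zero_of_tendsto_pow_smul {E : Type*} [NormedAddCommGroup E] [NormedSpace ℂ E] {k : ℕ}
    (hk : k ≠ 0) {c l : E} (h : Tendsto (fun s : ℕ => (s : ℂ) ^ k • c) atTop (𝓝 l)) : c = 0 := by
  have hinv : Tendsto (fun s : ℕ => ((s : ℂ)⁻¹) ^ k) atTop (𝓝 0) := by
    have : Tendsto (fun s : ℕ => (s : ℂ)⁻¹) atTop (𝓝 0) :=
      tendsto_inv_atTop_nhds_zero_nat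
    simpa [hk] using this.pow k
  have h1 := hinv.smul h
  rw [zero_smul] at h1
  refine tendsto_nhds_unique (Tendsto.congr' ?_ tendsto_const_nhds) h1
  filter_upwards [eventually_gt_atTop 0] with s hs
  have hs' : (s : ℂ) ≠ 0 := by exact_mod_cast hs.ne'
  rw [smul_smul, ← mul_pow, inv_mul_cancel₀ hs', one_pow, one_smul]

lemma eq_zero_of_two_pow_smul {E : Type*} [AddCommGroup E] [Module ℂ E] {k : ℕ} (hk : k ≠ 0)
    {x : E} (h : (2 : ℂ) ^ k • x = x) : x = 0 := by
  have h2 : ((2 : ℂ) ^ k - 1) • x = 0 := by rw [sub_smul, h, one_smul, sub_self]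
  refine (smul_eq_zero.1 h2).resolve_left (sub_ne_zero.2 fun h3 => ?_)
  have h4 : (2 : ℕ) ^ k = 1 := by exact_mod_cast h3
  exact absurd h4 (Nat.one_lt_two_pow hk).ne'

/-- A tangent field of weight at least three on a quadric of codimension three vanishes. -/
theorem ComplexTangent.eq_zero (h : ComplexTangent B f g f' g')
    (hstar : ∀ z ζ, star (B z ζ) = B (star ζ) (star z))
    (hnd : ∀ e, (∀ y, B y e = 0) → e = 0)
    (hspan : ∀ c : (Fin 3 → ℂ) →ₗ[ℂ] ℂ, (∀ z ζ, c (B z ζ) = 0) → c = 0)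
    (hf' : ContDiff ℂ 2 fun p : (Fin n → ℂ) × (Fin 3 → ℂ) => f' p.1 p.2)
    (hconj : ∀ z w, f z w = star (f' (star z) (star w))) {k : ℕ}
    (hfk : ∀ (s : ℂ) z w, s ≠ 0 → f (s • z) (s ^ 2 • w) = s ^ (k + 4) • f z w)
    (hgk : ∀ (s : ℂ) z w, s ≠ 0 → g (s • z) (s ^ 2 • w) = s ^ (k + 5) • g z w) :
    (∀ z w, f z w = 0) ∧ ∀ z w, g z w = 0 := by
  have hnd' : ∀ e, (∀ y, B e y = 0) → e = 0 := by
    intro e he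
    rw [← star_eq_zero]
    refine hnd _ fun y => ?_
    rw [← star_star y, ← hstar, he, star_zero]
  -- At `w = 0` the convergent quantity is `s ^ (k + 2)` times a constant.
  have hf0 : ∀ z, f z 0 = 0 := by
    intro z
    refine hnd' _ fun ζ => ?_
    have ht := h.tendsto hf'.continuous z ζ 0
    refine eq_zero_of_tendsto_pow_smul (k := k + 2) (by omega) (ht.congr' ?_)
    filter_upwards [eventually_gt_atTop 0] with s hs
    have hs' : (s : ℂ) ≠ 0 := by exact_mod_cast hs.ne'
    have := hfk s z 0 hs'
    rw [smul_zero] at this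
    rw [this, map_smul, LinearMap.smul_apply, smul_smul, show k + 4 = 2 + (k + 2) by ring,
      pow_add _ 2 (k + 2), inv_mul_cancel_left₀ (pow_ne_zero 2 hs')]
  have hf'0 : ∀ ζ, f' ζ 0 = 0 := by
    intro ζ
    have := hconj (star ζ) 0
    rw [hf0, star_star, star_zero] at this
    exact star_eq_zero.1 this.symm
  have hlin : ∀ (t : ℂ) z w, f z (t • w) = t • f z w := by
    intro t z w
    obtain ⟨T, hT⟩ := h.affine hstar hnd hspan hf' (star z)
    rw [hconj, hconj z w, hT, hT (star w), hf'0, zero_add, zero_add, star_smul, map_smul,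
      star_smul, star_star]
  -- Linearity in `w` uses up weight two, leaving degree `k + 2` in `z`. So `f 0 w = 0`, the limit
  -- in `tendsto` is zero, and `f` vanishes.
  have hfs : ∀ (s : ℂ) z w, s ≠ 0 → f (s • z) w = s ^ (k + 2) • f z w := by
    intro s z w hs
    have h1 := hfk s z ((s ^ 2)⁻¹ • w) hs
    rw [smul_inv_smul₀ (pow_ne_zero 2 hs), hlin, smul_smul] at h1
    rw [h1, show k + 4 = (k + 2) + 2 by ring, pow_add _ (k + 2) 2,
      mul_inv_cancel_right₀ (pow_ne_zero 2 hs)]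
  have hf0w : ∀ w, f 0 w = 0 := by
    intro w
    have h1 := hfs 2 0 w two_ne_zero
    rw [smul_zero] at h1
    exact eq_zero_of_two_pow_smul (by omega) h1.symm
  have hf'0w : ∀ w, f' 0 w = 0 := by
    intro w
    have := hconj 0 (star w)
    rw [hf0w, star_star, star_zero] at this
    exact star_eq_zero.1 this.symm
  have hf : ∀ z w, f z w = 0 := by
    intro z w
    refine hnd' _ fun ζ => ?_
    have ht := h.tendsto hf'.continuous z ζ w
    rw [hf'0w, hf'0w, sub_self] at ht
    have ht' : Tendsto (fun s : ℕ => (s : ℂ) ^ k • B (f z w) ζ) atTop (𝓝 0) := by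
      refine ht.congr' ?_
      filter_upwards [eventually_gt_atTop 0] with s hs
      have hs' : (s : ℂ) ≠ 0 := by exact_mod_cast hs.ne'
      rw [hfs _ _ _ hs', map_smul, LinearMap.smul_apply, smul_smul, show k + 2 = 2 + k by ring,
        pow_add _ 2 k, inv_mul_cancel_left₀ (pow_ne_zero 2 hs')]
    rcases Nat.eq_zero_or_pos k with rfl | hk
    · simp only [pow_zero, one_smul] at ht'
      exact tendsto_nhds_unique tendsto_const_nhds ht'
    · exact eq_zero_of_tendsto_pow_smul hk.ne' ht'
  have hf'z : ∀ ζ w, f' ζ w = 0 := by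
    intro ζ w
    have := hconj (star ζ) (star w)
    rw [hf, star_star, star_star] at this
    exact star_eq_zero.1 this.symm
  have hgz : ∀ z ζ w, g z w = g' ζ (w - (2 * I) • B z ζ) := by
    intro z ζ w
    have := h z ζ w
    rw [hf, hf'z] at this
    simpa [sub_eq_zero] using this
  have hg0 : ∀ z w, g z w = g 0 w := by
    intro z w
    rw [hgz z 0, hgz 0 0]
    simp
  -- With `f = 0`, `g` is independent of `z` and invariant under translation by the values of `B`.
  -- These span `ℂ³`, so `g` is constant, and its positive weight makes it zero.
  have hgB : ∀ z ζ w, g 0 (w + B z ζ) = g 0 w := by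
    intro z ζ w
    rw [← hg0 z, hgz z ((2 * I)⁻¹ • ζ), map_smul, smul_inv_smul₀ (by simp), add_sub_cancel_right,
      hgz 0 ((2 * I)⁻¹ • ζ)]
    simp
  have htop : Submodule.span ℂ {v | ∃ z ζ, v = B z ζ} = ⊤ := by
    by_contra hne
    obtain ⟨c, hc, hker⟩ := Submodule.exists_le_ker_of_lt_top _ (lt_top_iff_ne_top.2 hne)
    exact hc (hspan c fun z ζ => hker (Submodule.subset_span ⟨z, ζ, rfl⟩))
  have hgconst : ∀ v w, g 0 (w + v) = g 0 w := by
    intro v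
    have hv : v ∈ Submodule.span ℂ {v | ∃ z ζ, v = B z ζ} := htop ▸ Submodule.mem_top
    induction hv using Submodule.closure_induction with
    | zero => simp
    | add x y _ _ hx hy => intro w; rw [← add_assoc, hy, hx]
    | smul_mem r x hx =>
      obtain ⟨z, ζ, rfl⟩ := hx
      intro w
      rw [← map_smul, hgB]
  refine ⟨hf, fun z w => ?_⟩
  rw [hg0, ← zero_add w, hgconst]
  have h1 := hgk 2 0 0 two_ne_zero
  rw [smul_zero, smul_zero] at h1
  exact eq_zero_of_two_pow_smul (by omega) h1.symm

end Calculus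

/-! ### Tangency on the quadric and weight parts of jets -/

namespace CRQuadric

open Filter Asymptotics MvPolynomial

variable {n k : ℕ}

/-- The Hermitian form of a quadric as a complex bilinear map, `form z ζ = bilin z ζ̄`. -/
def bilin (Q : CRQuadric n k) : (Fin n → ℂ) →ₗ[ℂ] (Fin n → ℂ) →ₗ[ℂ] (Fin k → ℂ) :=
  LinearMap.mk₂ ℂ (fun z ζ j => ζ ⬝ᵥ (Q.mat j *ᵥ z))
    (fun _ _ _ => by ext; simp [Matrix.mulVec_add])
    (fun _ _ _ => by ext; simp [Matrix.mulVec_smul])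
    (fun _ _ _ => by ext; simp)
    (fun _ _ _ => by ext; simp)

lemma form_eq_bilin (Q : CRQuadric n k) (z ζ : Fin n → ℂ) : Q.form z ζ = Q.bilin z (star ζ) := rfl

lemma star_bilin (Q : CRQuadric n k) (z ζ : Fin n → ℂ) :
    star (Q.bilin z ζ) = Q.bilin (star ζ) (star z) := by
  ext j
  simp only [bilin, LinearMap.mk₂_apply, Pi.star_apply]
  rw [← Matrix.star_dotProduct_star, Matrix.star_mulVec, (Q.isHermitian j).eq,
    Matrix.dotProduct_mulVec]

lemma Nondegenerate.bilin_eq_zero {Q : CRQuadric n k} (hQ : Q.Nondegenerate) (e : Fin n → ℂ)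
    (he : ∀ y, Q.bilin y e = 0) : e = 0 := by
  rw [← star_eq_zero]
  refine hQ.1 _ fun z => ?_
  rw [form_eq_bilin, ← star_bilin, he, star_zero]

/-- Hermitian matrices independent over `ℝ` are independent over `ℂ`: the conjugate transpose of a
complex relation is the relation with conjugate coefficients, and sum and difference give real
relations. -/
lemma Nondegenerate.bilin_span {Q : CRQuadric n k} (hQ : Q.Nondegenerate)
    (c : (Fin k → ℂ) →ₗ[ℂ] ℂ) (hc : ∀ z ζ, c (Q.bilin z ζ) = 0) : c = 0 := by
  let d : Fin k → ℂ := fun j => c (Pi.single j 1)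
  have hcd : ∀ x, c x = ∑ j, d j * x j := by
    intro x
    conv_lhs => rw [pi_eq_sum_univ' x]
    simp only [map_sum, map_smul, smul_eq_mul, d]
    exact Finset.sum_congr rfl fun j _ => mul_comm _ _
  have hsum : ∑ j, d j • Q.mat j = 0 := by
    ext a b
    have := hc (Pi.single b 1) (Pi.single a 1)
    rw [hcd] at this
    simpa [bilin, Matrix.sum_apply] using this
  have hsum' : ∑ j, star (d j) • Q.mat j = 0 := by
    have := congrArg Matrix.conjTranspose hsum
    simpa [Matrix.conjTranspose_sum, (Q.isHermitian _).eq] using this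
  have hre := Fintype.linearIndependent_iff.1 hQ.2 (fun j => (d j).re) (by
    have : ∑ j, (2 : ℂ) • ((d j).re • Q.mat j) = 0 := by
      rw [← add_zero (0 : Matrix (Fin n) (Fin n) ℂ)]
      nth_rewrite 1 [← hsum]
      rw [← hsum', ← Finset.sum_add_distrib]
      refine Finset.sum_congr rfl fun j _ => ?_
      ext a b
      simp only [Matrix.smul_apply, Matrix.add_apply, Complex.real_smul, smul_eq_mul]
      rw [← add_mul, Complex.star_def, Complex.add_conj]
      push_cast
      ring
    rw [← Finset.smul_sum] at this
    exact (smul_eq_zero.1 this).resolve_left two_ne_zero)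
  have him := Fintype.linearIndependent_iff.1 hQ.2 (fun j => (d j).im) (by
    have : ∑ j, (2 * Complex.I : ℂ) • ((d j).im • Q.mat j) = 0 := by
      rw [← sub_zero (0 : Matrix (Fin n) (Fin n) ℂ)]
      nth_rewrite 1 [← hsum]
      rw [← hsum', ← Finset.sum_sub_distrib]
      refine Finset.sum_congr rfl fun j _ => ?_
      ext a b
      simp only [Matrix.smul_apply, Matrix.sub_apply, Complex.real_smul, smul_eq_mul]
      rw [← sub_mul, Complex.star_def, Complex.sub_conj]
      push_cast
      ring
    rw [← Finset.smul_sum] at this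
    exact (smul_eq_zero.1 this).resolve_left (by simp))
  have hd : ∀ j, d j = 0 := fun j => Complex.ext (hre j) (him j)
  exact LinearMap.ext fun x => by simp [hcd, hd]

/-- The value of the differential of the defining function at `p` on the tangent vector `v`. -/
def tangency (Q : CRQuadric n k) (p v : CxSpace n k) : Fin k → ℝ :=
  fun j => (v.2 j).im - 2 * (Q.form v.1 p.1 j).re

lemma fderiv_definingFun (Q : CRQuadric n k) (p v : CxSpace n k) :
    fderiv ℝ Q.definingFun p v = Q.tangency p v := by
  have h1 : HasDerivAt (fun t : ℝ => Q.definingFun (p + t • v)) (fderiv ℝ Q.definingFun p v) 0 := by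
    have h2 : HasDerivAt (fun t : ℝ => p + t • v) v 0 := by
      simpa using ((hasDerivAt_id (0 : ℝ)).smul_const v).const_add p
    have h3 := (Q.differentiable_definingFun (p + (0 : ℝ) • v)).hasFDerivAt
    have h4 := h3.comp_hasDerivAt (0 : ℝ) h2
    rw [zero_smul, add_zero] at h4
    exact h4
  refine h1.unique (hasDerivAt_pi.2 fun j => ?_)
  have h5 : ∀ t : ℝ, Q.definingFun (p + t • v) j = Q.definingFun p j + t * Q.tangency p v j -
      t ^ 2 * (Q.form v.1 v.1 j).re := by
    intro t
    have hs : (Q.form p.1 v.1 j).re = (Q.form v.1 p.1 j).re := by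
      have := congrFun (Q.star_bilin p.1 (star v.1)) j
      rw [star_star] at this
      rw [form_eq_bilin, form_eq_bilin, ← this]
      simp
    have hv : (p + t • v).1 = p.1 + (t : ℂ) • v.1 := by
      ext i; simp
    have hexp : Q.form (p.1 + (t : ℂ) • v.1) (p.1 + (t : ℂ) • v.1) j = Q.form p.1 p.1 j +
        t * (Q.form p.1 v.1 j + Q.form v.1 p.1 j) + t ^ 2 * Q.form v.1 v.1 j := by
      simp only [form_eq_bilin, star_add, star_smul, map_add, map_smul, LinearMap.add_apply,
        LinearMap.smul_apply, Pi.add_apply, Pi.smul_apply, smul_eq_mul, Complex.star_def,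
        Complex.conj_ofReal]
      ring
    simp only [definingFun, tangency]
    rw [hv, hexp]
    simp only [Complex.add_re, Complex.re_ofReal_mul, hs, ← Complex.ofReal_pow, Prod.snd_add,
      Prod.smul_snd, Pi.add_apply, Pi.smul_apply, Complex.add_im, Complex.real_smul,
      Complex.im_ofReal_mul]
    ring
  have h7 : (fun t : ℝ => Q.definingFun (p + t • v) j) = _ := funext h5
  rw [h7]
  have h6 := ((((hasDerivAt_id (0 : ℝ)).mul_const (Q.tangency p v j)).const_add
    (Q.definingFun p j)).sub ((hasDerivAt_pow 2 (0 : ℝ)).mul_const ((Q.form v.1 v.1 j).re)))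
  convert! h6 using 1
  simp

/-- The weighted dilation `(z, w) ↦ (s z, s² w)`. -/
def dilate (s : ℂ) (p : CxSpace n k) : CxSpace n k := (s • p.1, s ^ 2 • p.2)

lemma dilate_mem_carrier {Q : CRQuadric n k} {p : CxSpace n k} (hp : p ∈ Q.carrier) (s : ℝ) :
    dilate (s : ℂ) p ∈ Q.carrier := by
  ext j
  have h := congrFun hp j
  simp only [definingFun, dilate, form_eq_bilin, star_smul, map_smul, LinearMap.smul_apply,
    Pi.smul_apply, smul_eq_mul, Complex.star_def, Complex.conj_ofReal, ← Complex.ofReal_pow,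
    Complex.re_ofReal_mul, Complex.im_ofReal_mul, Pi.zero_apply] at h ⊢
  linear_combination s ^ 2 * h

lemma zpow_sum_eq_prod {ι : Type*} {s : ℂ} (hs : s ≠ 0) (t : Finset ι) (a : ι → ℤ) :
    s ^ (∑ i ∈ t, a i) = ∏ i ∈ t, s ^ a i := by
  classical
  induction t using Finset.induction_on with
  | empty => simp
  | insert i t hi ih => rw [Finset.sum_insert hi, Finset.prod_insert hi, zpow_add₀ hs, ih]

lemma eval_dilate {P : MvPolynomial (Fin n ⊕ Fin k) ℂ} {m : ℤ}
    (hP : P.IsWeightedHomogeneous (varWeight n k) m) {s : ℂ} (hs : s ≠ 0) (p : CxSpace n k) :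
    eval (Sum.elim (dilate s p).1 (dilate s p).2) P = s ^ m * eval (Sum.elim p.1 p.2) P := by
  rw [eval_eq', eval_eq', Finset.mul_sum]
  refine Finset.sum_congr rfl fun d hd => ?_
  have hd' := hP (mem_support_iff.1 hd)
  have hx : ∀ i, Sum.elim (dilate s p).1 (dilate s p).2 i =
      s ^ (varWeight n k i) * Sum.elim p.1 p.2 i := by
    rintro (i | i)
    · simp [dilate, varWeight]
    · simp [dilate, varWeight]
  have hw : s ^ m = ∏ i, (s ^ varWeight n k i) ^ d i := by
    rw [← hd', Finsupp.weight_apply, Finsupp.sum_fintype _ _ (by simp), zpow_sum_eq_prod hs]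
    refine Finset.prod_congr rfl fun i _ => ?_
    rw [nsmul_eq_mul, mul_comm, zpow_mul, zpow_natCast]
  simp only [hx, mul_pow, Finset.prod_mul_distrib, hw]
  ring

lemma tendsto_zpow_nhdsGT_zero {a : ℤ} (ha : 0 < a) :
    Tendsto (fun s : ℝ => s ^ a) (𝓝[>] 0) (𝓝 0) := by
  obtain ⟨b, rfl⟩ := Int.eq_ofNat_of_zero_le ha.le
  have hb : b ≠ 0 := by omega
  have : Tendsto (fun s : ℝ => s ^ b) (𝓝[>] 0) (𝓝 (0 ^ b)) :=
    ((continuous_pow b).tendsto 0).mono_left nhdsWithin_le_nhds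
  simpa [hb] using this

/-- Divide by `s ^ w₀`, with `w₀` the least exponent below `M` carrying a nonzero coefficient: the
sum tends to `c w₀`, the bound to zero. -/
lemma coeff_eq_zero_of_isBigO (S : Finset ℤ) (c : ℤ → ℝ) (M : ℤ)
    (h : (fun s : ℝ => ∑ w ∈ S, s ^ w * c w) =O[𝓝[>] 0] fun s => s ^ M) :
    ∀ w ∈ S, w < M → c w = 0 := by
  by_contra! hne
  have hT : (S.filter fun w => w < M ∧ c w ≠ 0).Nonempty := by
    obtain ⟨w, hw, hwM, hcw⟩ := hne
    exact ⟨w, by simp [hw, hwM, hcw]⟩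
  set w₀ := (S.filter fun w => w < M ∧ c w ≠ 0).min' hT with hw₀
  have hmem := Finset.min'_mem _ hT
  rw [← hw₀, Finset.mem_filter] at hmem
  have hmin : ∀ w ∈ S, w ≠ w₀ → c w = 0 ∨ 0 < w - w₀ := by
    intro w hw hne
    by_cases hcw : c w = 0
    · exact Or.inl hcw
    · right
      by_cases hwM : w < M
      · have := Finset.min'_le (S.filter fun w => w < M ∧ c w ≠ 0) w (by simp [hw, hwM, hcw])
        omega
      · omega
  have h1 : Tendsto (fun s : ℝ => ∑ w ∈ S, s ^ (w - w₀) * c w) (𝓝[>] 0) (𝓝 (c w₀)) := by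
    have h2 : ∀ w ∈ S, Tendsto (fun s : ℝ => s ^ (w - w₀) * c w) (𝓝[>] 0)
        (𝓝 (if w = w₀ then c w₀ else 0)) := by
      intro w hw
      split_ifs with hww
      · simp [hww]
      · rcases hmin w hw hww with h0 | h0
        · simp [h0]
        · simpa using (tendsto_zpow_nhdsGT_zero h0).mul_const (c w)
    have h3 := tendsto_finsetSum S h2
    simpa [hmem.1] using h3
  have h4 : Tendsto (fun s : ℝ => ∑ w ∈ S, s ^ (w - w₀) * c w) (𝓝[>] 0) (𝓝 0) := by
    have h5 := (isBigO_refl (fun s : ℝ => s ^ (-w₀)) (𝓝[>] 0)).mul h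
    refine (h5.congr' ?_ ?_).trans_tendsto (tendsto_zpow_nhdsGT_zero (a := M - w₀) (by omega))
    · filter_upwards [self_mem_nhdsWithin] with s hs
      rw [Finset.mul_sum]
      refine Finset.sum_congr rfl fun w _ => ?_
      rw [← mul_assoc, ← zpow_add₀ (ne_of_gt hs), neg_add_eq_sub]
    · filter_upwards [self_mem_nhdsWithin] with s hs
      rw [← zpow_add₀ (ne_of_gt hs), neg_add_eq_sub]
  exact hmem.2.2 (tendsto_nhds_unique h1 h4)

/-- The part of weight `m` of a polynomial field. -/
def weightPart (f : Fin n → MvPolynomial (Fin n ⊕ Fin k) ℂ)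
    (g : Fin k → MvPolynomial (Fin n ⊕ Fin k) ℂ) (m : ℤ) : CxSpace n k → CxSpace n k :=
  polyField (fun i => weightedHomogeneousComponent (varWeight n k) (m + 1) (f i))
    (fun j => weightedHomogeneousComponent (varWeight n k) (m + 2) (g j))

lemma sum_component_of_support {P : MvPolynomial (Fin n ⊕ Fin k) ℂ} (a : ℤ) {S : Finset ℤ}
    (hS : ∀ d, coeff d P ≠ 0 → Finsupp.weight (varWeight n k) d - a ∈ S) :
    ∑ m ∈ S, weightedHomogeneousComponent (varWeight n k) (m + a) P = P := by
  ext d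
  rw [coeff_sum]
  simp only [coeff_weightedHomogeneousComponent]
  by_cases hd : coeff d P = 0
  · simp [hd]
  · rw [Finset.sum_eq_single_of_mem _ (hS d hd)]
    · simp
    · intro m _ hm
      rw [if_neg]
      omega

lemma polyField_eq_sum_weightPart (f : Fin n → MvPolynomial (Fin n ⊕ Fin k) ℂ)
    (g : Fin k → MvPolynomial (Fin n ⊕ Fin k) ℂ) {S : Finset ℤ}
    (hf : ∀ i d, coeff d (f i) ≠ 0 → Finsupp.weight (varWeight n k) d - 1 ∈ S)
    (hg : ∀ j d, coeff d (g j) ≠ 0 → Finsupp.weight (varWeight n k) d - 2 ∈ S)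
    (p : CxSpace n k) : polyField f g p = ∑ m ∈ S, weightPart f g m p := by
  refine Prod.ext ?_ ?_
  · ext i
    rw [Prod.fst_sum, Finset.sum_apply]
    simp only [polyField, weightPart]
    rw [← map_sum, sum_component_of_support 1 (hf i)]
  · ext j
    rw [Prod.snd_sum, Finset.sum_apply]
    simp only [polyField, weightPart]
    rw [← map_sum, sum_component_of_support 2 (hg j)]

lemma weightPart_dilate (f : Fin n → MvPolynomial (Fin n ⊕ Fin k) ℂ)
    (g : Fin k → MvPolynomial (Fin n ⊕ Fin k) ℂ) (m : ℤ) {s : ℂ} (hs : s ≠ 0)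
    (p : CxSpace n k) :
    weightPart f g m (dilate s p) = s ^ m • dilate s (weightPart f g m p) := by
  refine Prod.ext ?_ ?_
  · ext i
    simp only [weightPart, polyField]
    rw [eval_dilate (weightedHomogeneousComponent_isWeightedHomogeneous _ _) hs, zpow_add₀ hs]
    simp [dilate, mul_assoc]
  · ext j
    simp only [weightPart, polyField]
    rw [eval_dilate (weightedHomogeneousComponent_isWeightedHomogeneous _ _) hs, zpow_add₀ hs]
    simp [dilate, mul_assoc]

lemma tangency_dilate (Q : CRQuadric n k) (s r : ℝ) (p v : CxSpace n k) :
    Q.tangency (dilate s p) ((r : ℂ) • dilate s v) = (r * s ^ 2) • Q.tangency p v := by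
  ext j
  simp only [tangency, dilate, form_eq_bilin, star_smul, map_smul, LinearMap.smul_apply,
    Prod.smul_fst, Prod.smul_snd,
    Pi.smul_apply, smul_eq_mul, Complex.star_def, Complex.conj_ofReal, ← Complex.ofReal_pow,
    Complex.re_ofReal_mul, Complex.im_ofReal_mul]
  ring

lemma exists_tangency_bound (Q : CRQuadric n k) :
    ∃ K, 0 ≤ K ∧ ∀ p v j, |Q.tangency p v j| ≤ (1 + K * ‖p‖) * ‖v‖ := by
  let C : (Fin n → ℂ) →L[ℂ] (Fin n → ℂ) →L[ℂ] (Fin k → ℂ) :=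
    LinearMap.toContinuousLinearMap (LinearMap.toContinuousLinearMap.toLinearMap ∘ₗ Q.bilin)
  refine ⟨2 * ‖C‖, by positivity, fun p v j => ?_⟩
  have h1 : |(v.2 j).im| ≤ ‖v‖ :=
    (Complex.abs_im_le_norm _).trans ((norm_le_pi_norm v.2 j).trans (norm_snd_le v))
  have h2 : |(Q.form v.1 p.1 j).re| ≤ ‖C‖ * ‖v‖ * ‖p‖ := by
    refine (Complex.abs_re_le_norm _).trans ((norm_le_pi_norm (Q.form v.1 p.1) j).trans ?_)
    have h3 := C.le_opNorm₂ v.1 (star p.1)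
    rw [norm_star] at h3
    refine h3.trans ?_
    gcongr
    · exact norm_fst_le v
    · exact norm_fst_le p
  simp only [tangency]
  refine (abs_sub _ _).trans ?_
  rw [abs_mul, abs_two]
  nlinarith

lemma norm_dilate_le {s : ℝ} (hs : 0 ≤ s) (hs1 : s ≤ 1) (p : CxSpace n k) :
    ‖dilate (s : ℂ) p‖ ≤ s * ‖p‖ := by
  simp only [dilate, Prod.norm_def, norm_smul, norm_pow, Complex.norm_real, Real.norm_eq_abs,
    abs_of_nonneg hs]
  refine max_le ?_ ?_
  · gcongr
    exact le_max_left _ _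
  · gcongr
    · nlinarith
    · exact le_max_right _ _

/-- The weighted parts of a sufficiently long jet of a tangent field are tangent. -/
lemma tangency_weightPart (Q : CRQuadric n k) {X : CxSpace n k → CxSpace n k}
    {f : Fin n → MvPolynomial (Fin n ⊕ Fin k) ℂ} {g : Fin k → MvPolynomial (Fin n ⊕ Fin k) ℂ}
    {M : ℕ} (hX : (fun y => X y - polyField f g y) =O[𝓝 0] fun y => ‖y‖ ^ M)
    (htan : ∀ᶠ p in 𝓝 0, p ∈ Q.carrier → Q.tangency p (X p) = 0) {m : ℤ} (hm : m + 2 < M)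
    {p : CxSpace n k} (hp : p ∈ Q.carrier) : Q.tangency p (weightPart f g m p) = 0 := by
  classical
  -- Inserting `m` allows its coefficient to be read off even if no monomial has that weight.
  let S : Finset ℤ := insert m
    ((Finset.univ.biUnion fun i =>
      (f i).support.image fun d => Finsupp.weight (varWeight n k) d - 1) ∪
    (Finset.univ.biUnion fun j =>
      (g j).support.image fun d => Finsupp.weight (varWeight n k) d - 2))
  have hSf : ∀ i d, coeff d (f i) ≠ 0 → Finsupp.weight (varWeight n k) d - 1 ∈ S := by
    intro i d hd
    refine Finset.mem_insert_of_mem (Finset.mem_union_left _ ?_)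
    exact Finset.mem_biUnion.2 ⟨i, Finset.mem_univ _,
      Finset.mem_image.2 ⟨d, mem_support_iff.2 hd, rfl⟩⟩
  have hSg : ∀ j d, coeff d (g j) ≠ 0 → Finsupp.weight (varWeight n k) d - 2 ∈ S := by
    intro j d hd
    refine Finset.mem_insert_of_mem (Finset.mem_union_right _ ?_)
    exact Finset.mem_biUnion.2 ⟨j, Finset.mem_univ _,
      Finset.mem_image.2 ⟨d, mem_support_iff.2 hd, rfl⟩⟩
  ext j
  -- On the dilation orbit of `p` the part of weight `a` contributes order `s ^ (a + 2)`, since the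
  -- defining function has weight two. The jet error is `O(s ^ M)`.
  have hτ : ∀ s : ℝ, 0 < s → Q.tangency (dilate s p) (polyField f g (dilate s p)) j =
      ∑ a ∈ S, s ^ (a + 2) * Q.tangency p (weightPart f g a p) j := by
    intro s hs
    have hs' : (s : ℂ) ≠ 0 := by exact_mod_cast hs.ne'
    rw [polyField_eq_sum_weightPart f g hSf hSg, ← fderiv_definingFun, map_sum, Finset.sum_apply]
    refine Finset.sum_congr rfl fun a _ => ?_
    rw [fderiv_definingFun, weightPart_dilate f g a hs', ← Complex.ofReal_zpow, tangency_dilate,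
      zpow_add₀ hs.ne']
    rfl
  obtain ⟨K, hK, hbound⟩ := Q.exists_tangency_bound
  have hdil : Tendsto (fun s : ℝ => dilate (s : ℂ) p) (𝓝[>] 0) (𝓝 0) := by
    have hc : Continuous fun s : ℝ => dilate (s : ℂ) p := by
      unfold dilate
      fun_prop
    have h0 : dilate ((0 : ℝ) : ℂ) p = 0 := by simp [dilate]
    exact h0 ▸ (hc.tendsto 0).mono_left nhdsWithin_le_nhds
  have hsmall : ∀ᶠ s : ℝ in 𝓝[>] 0, s ≤ 1 :=
    nhdsWithin_le_nhds (eventually_le_nhds zero_lt_one)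
  have hO : (fun s : ℝ => Q.tangency (dilate s p) (polyField f g (dilate s p)) j)
      =O[𝓝[>] 0] fun s => s ^ (M : ℤ) := by
    obtain ⟨C, hC⟩ := (hX.comp_tendsto hdil).bound
    refine IsBigO.of_bound ((1 + K * ‖p‖) * (|C| * ‖p‖ ^ M)) ?_
    filter_upwards [hC, hdil.eventually htan, hsmall, self_mem_nhdsWithin] with s h1 h2 h3 h4
    have h4' : 0 < s := h4
    have h5 := h2 (dilate_mem_carrier hp s)
    have h6 : Q.tangency (dilate s p) (polyField f g (dilate s p)) j =
        - Q.tangency (dilate s p) (X (dilate s p) - polyField f g (dilate s p)) j := by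
      rw [← fderiv_definingFun, ← fderiv_definingFun, map_sub, fderiv_definingFun,
        fderiv_definingFun, h5]
      simp
    have h7 := norm_dilate_le h4'.le h3 p
    have h8 : ‖dilate (s : ℂ) p‖ ≤ ‖p‖ := h7.trans (by nlinarith [norm_nonneg p])
    rw [h6, norm_neg, Real.norm_eq_abs]
    refine (hbound _ _ _).trans ?_
    simp only [Function.comp_apply, norm_pow, norm_norm] at h1
    have h9 : ‖X (dilate s p) - polyField f g (dilate s p)‖ ≤ |C| * (s * ‖p‖) ^ M := by
      refine h1.trans ?_
      gcongr
      exact le_abs_self C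
    rw [zpow_natCast, Real.norm_eq_abs, abs_of_pos (pow_pos h4' M)]
    calc (1 + K * ‖dilate (s : ℂ) p‖) * ‖X (dilate s p) - polyField f g (dilate s p)‖
        ≤ (1 + K * ‖p‖) * (|C| * (s * ‖p‖) ^ M) := by gcongr
      _ = _ := by rw [mul_pow]; ring
  have hO' : (fun s : ℝ => ∑ w ∈ S.image (· + 2),
      s ^ w * Q.tangency p (weightPart f g (w - 2) p) j) =O[𝓝[>] 0] fun s => s ^ (M : ℤ) := by
    refine hO.congr' ?_ EventuallyEq.rfl
    filter_upwards [self_mem_nhdsWithin] with s hs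
    rw [hτ s hs, Finset.sum_image (fun a _ b _ h => by simpa using h)]
    simp
  have := coeff_eq_zero_of_isBigO _ _ _ hO' (m + 2)
    (Finset.mem_image_of_mem _ (Finset.mem_insert_self _ _)) hm
  simpa using this

end CRQuadric

namespace CRQuadric

open Filter Asymptotics MvPolynomial

/-! ### Polynomial tangent fields of weight at least three -/

section Vanishing

variable {n k : ℕ}

lemma contDiff_eval (P : MvPolynomial (Fin n ⊕ Fin k) ℂ) {N : WithTop ℕ∞} :
    ContDiff ℂ N fun p : CxSpace n k => eval (Sum.elim p.1 p.2) P := by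
  induction P using MvPolynomial.induction_on with
  | C a => simpa using contDiff_const
  | add P P' h h' => simpa using h.add h'
  | mul_X P i h =>
    have hi : ContDiff ℂ N fun p : CxSpace n k => Sum.elim p.1 p.2 i := by
      rcases i with i | i
      · exact (contDiff_apply ℂ ℂ i).comp contDiff_fst
      · exact (contDiff_apply ℂ ℂ i).comp contDiff_snd
    simpa using h.mul hi

lemma eval_map_star (P : MvPolynomial (Fin n ⊕ Fin k) ℂ) (z : Fin n → ℂ) (w : Fin k → ℂ) :
    eval (Sum.elim (star z) (star w)) (map (starRingEnd ℂ) P) = star (eval (Sum.elim z w) P) := by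
  induction P using MvPolynomial.induction_on with
  | C a => simp
  | add P P' h h' => simp [h, h']
  | mul_X P i h =>
    rw [map_mul, map_mul, map_mul, h, map_X, eval_X, eval_X, star_mul']
    rcases i with i | i <;> rfl

lemma polyField_eq_zero {f : Fin n → MvPolynomial (Fin n ⊕ Fin k) ℂ}
    {g : Fin k → MvPolynomial (Fin n ⊕ Fin k) ℂ} (h : ∀ p, polyField f g p = 0) :
    f = 0 ∧ g = 0 := by
  have hx : ∀ x : Fin n ⊕ Fin k → ℂ, x = Sum.elim (x ∘ Sum.inl) (x ∘ Sum.inr) :=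
    fun x => (Sum.elim_comp_inl_inr x).symm
  refine ⟨funext fun i => MvPolynomial.funext fun x => ?_,
    funext fun j => MvPolynomial.funext fun x => ?_⟩
  · rw [hx x]
    simpa [polyField] using congrFun (congrArg Prod.fst (h (x ∘ Sum.inl, x ∘ Sum.inr))) i
  · rw [hx x]
    simpa [polyField] using congrFun (congrArg Prod.snd (h (x ∘ Sum.inl, x ∘ Sum.inr))) j

/-- The polynomial field `(f, g)` with conjugate coefficients. -/
def conjField (f : Fin n → MvPolynomial (Fin n ⊕ Fin k) ℂ)
    (g : Fin k → MvPolynomial (Fin n ⊕ Fin k) ℂ) : CxSpace n k → CxSpace n k :=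
  polyField (fun i => map (starRingEnd ℂ) (f i)) (fun j => map (starRingEnd ℂ) (g j))

lemma conjField_star (f : Fin n → MvPolynomial (Fin n ⊕ Fin k) ℂ)
    (g : Fin k → MvPolynomial (Fin n ⊕ Fin k) ℂ) (z : Fin n → ℂ) (w : Fin k → ℂ) :
    conjField f g (star z, star w) = star (polyField f g (z, w)) := by
  refine Prod.ext (funext fun i => ?_) (funext fun j => ?_)
  · simp only [conjField, polyField, eval_map_star, Prod.fst_star, Pi.star_apply]
  · simp only [conjField, polyField, eval_map_star, Prod.snd_star, Pi.star_apply]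

lemma contDiff_polyField (f : Fin n → MvPolynomial (Fin n ⊕ Fin k) ℂ)
    (g : Fin k → MvPolynomial (Fin n ⊕ Fin k) ℂ) {N : WithTop ℕ∞} :
    ContDiff ℂ N (polyField f g) :=
  ContDiff.prodMk (contDiff_pi.2 fun i => contDiff_eval (f i))
    (contDiff_pi.2 fun j => contDiff_eval (g j))

lemma complexTangent_polyField {Q : CRQuadric n 3}
    {f : Fin n → MvPolynomial (Fin n ⊕ Fin 3) ℂ} {g : Fin 3 → MvPolynomial (Fin n ⊕ Fin 3) ℂ}
    (htan : ∀ p ∈ Q.carrier, Q.tangency p (polyField f g p) = 0) :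
    ComplexTangent Q.bilin (fun z w => (polyField f g (z, w)).1)
      (fun z w => (polyField f g (z, w)).2) (fun z w => (conjField f g (z, w)).1)
      (fun z w => (conjField f g (z, w)).2) := by
  have h1 : Differentiable ℂ (polyField f g) :=
    (contDiff_polyField (N := 1) f g).differentiable one_ne_zero
  have h2 : Differentiable ℂ (conjField f g) :=
    (contDiff_polyField (N := 1) _ _).differentiable one_ne_zero
  refine complexTangent_of_real Q.star_bilin h1.fst h1.snd h2.fst h2.snd fun z w hzw => ?_
  have hmem : ((z, w) : CxSpace n 3) ∈ Q.carrier := by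
    ext j
    have h1 := congrFun hzw j
    simp only [Pi.sub_apply, Pi.star_apply, Complex.star_def, Pi.smul_apply, smul_eq_mul,
      Complex.sub_conj] at h1
    have h2 : Q.bilin z (star z) j = ((w j).im : ℂ) := by
      refine mul_left_cancel₀ (mul_ne_zero two_ne_zero Complex.I_ne_zero) ?_
      rw [← h1]; push_cast; ring
    simp [definingFun, form_eq_bilin, h2]
  have h3 := htan _ hmem
  rw [conjField_star]
  generalize polyField f g (z, w) = v at h3 ⊢
  have h6 : Q.bilin z (star v.1) = star (Q.bilin v.1 (star z)) := by
    rw [Q.star_bilin, star_star]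
  ext j
  have h4 := congrFun h3 j
  simp only [tangency, form_eq_bilin, Pi.zero_apply] at h4
  simp only [Prod.fst_star, Prod.snd_star, h6, Pi.sub_apply, Pi.star_apply, Complex.star_def,
    Pi.smul_apply, Pi.add_apply, smul_eq_mul, Complex.sub_conj, Complex.add_conj]
  have h5 : (v.2 j).im = 2 * (Q.bilin v.1 (star z) j).re := by
    linear_combination h4
  rw [h5]
  push_cast
  ring

lemma polyField_dilate {f : Fin n → MvPolynomial (Fin n ⊕ Fin k) ℂ}
    {g : Fin k → MvPolynomial (Fin n ⊕ Fin k) ℂ} {m : ℤ}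
    (hf : ∀ i, (f i).IsWeightedHomogeneous (varWeight n k) (m + 1))
    (hg : ∀ j, (g j).IsWeightedHomogeneous (varWeight n k) (m + 2)) {s : ℂ} (hs : s ≠ 0)
    (p : CxSpace n k) :
    polyField f g (dilate s p) =
      (s ^ (m + 1) • (polyField f g p).1, s ^ (m + 2) • (polyField f g p).2) :=
  Prod.ext (funext fun i => eval_dilate (hf i) hs p) (funext fun j => eval_dilate (hg j) hs p)

/-- On a nondegenerate quadric of codimension three there are no nonzero tangent fields of weight
at least three. -/
lemma eq_zero_of_three_le_weight {Q : CRQuadric n 3} (hQ : Q.Nondegenerate) {m : ℤ} (hm : 3 ≤ m)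
    {f : Fin n → MvPolynomial (Fin n ⊕ Fin 3) ℂ} {g : Fin 3 → MvPolynomial (Fin n ⊕ Fin 3) ℂ}
    (hf : ∀ i, (f i).IsWeightedHomogeneous (varWeight n 3) (m + 1))
    (hg : ∀ j, (g j).IsWeightedHomogeneous (varWeight n 3) (m + 2))
    (htan : ∀ p ∈ Q.carrier, Q.tangency p (polyField f g p) = 0) : f = 0 ∧ g = 0 := by
  obtain ⟨k, rfl⟩ : ∃ k : ℕ, m = k + 3 := ⟨(m - 3).toNat, by omega⟩
  have hdil : ∀ (s : ℂ) z w, s ≠ 0 → polyField f g (s • z, s ^ 2 • w) =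
      (s ^ (k + 4) • (polyField f g (z, w)).1, s ^ (k + 5) • (polyField f g (z, w)).2) := by
    intro s z w hs
    have := polyField_dilate hf hg hs (z, w)
    rw [show ((k : ℤ) + 3 + 1) = ((k + 4 : ℕ) : ℤ) by push_cast; ring,
      show ((k : ℤ) + 3 + 2) = ((k + 5 : ℕ) : ℤ) by push_cast; ring, zpow_natCast,
      zpow_natCast] at this
    exact this
  obtain ⟨h1, h2⟩ := (complexTangent_polyField htan).eq_zero (k := k) Q.star_bilin
    hQ.bilin_eq_zero hQ.bilin_span (contDiff_polyField _ _).fst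
    (fun z w => by rw [conjField_star, Prod.fst_star, star_star])
    (fun s z w hs => by rw [hdil s z w hs]) (fun s z w hs => by rw [hdil s z w hs])
  exact polyField_eq_zero fun p => Prod.ext (h1 p.1 p.2) (h2 p.1 p.2)

end Vanishing

/-! ### Taylor polynomials of analytic fields -/

section Jets

variable {n k : ℕ}

/-- The standard basis of `ℂⁿ × ℂᵏ`. -/
def basisVec : Fin n ⊕ Fin k → CxSpace n k :=
  Sum.elim (fun i => (Pi.single i 1, 0)) (fun j => (0, Pi.single j 1))

lemma eq_sum_basisVec (y : CxSpace n k) : y = ∑ x, Sum.elim y.1 y.2 x • basisVec x := by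
  rw [Fintype.sum_sum_type]
  refine Prod.ext ?_ ?_
  · ext i
    simp [basisVec, Prod.fst_sum, Finset.sum_apply, Pi.single_apply]
  · ext j
    simp [basisVec, Prod.snd_sum, Finset.sum_apply, Pi.single_apply]

/-- The homogeneous polynomial `y ↦ φ (y, …, y)` of a multilinear form `φ`. -/
def diagPoly {N : ℕ} (φ : ContinuousMultilinearMap ℂ (fun _ : Fin N => CxSpace n k) ℂ) :
    MvPolynomial (Fin n ⊕ Fin k) ℂ :=
  ∑ r : Fin N → Fin n ⊕ Fin k, C (φ fun a => basisVec (r a)) * ∏ a, X (r a)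

lemma eval_diagPoly {N : ℕ} (φ : ContinuousMultilinearMap ℂ (fun _ : Fin N => CxSpace n k) ℂ)
    (y : CxSpace n k) : eval (Sum.elim y.1 y.2) (diagPoly φ) = φ fun _ => y := by
  classical
  conv_rhs => rw [eq_sum_basisVec y, φ.map_sum]
  simp only [diagPoly, map_sum, map_mul, eval_C, map_prod, eval_X]
  refine Finset.sum_congr rfl fun r _ => ?_
  rw [φ.map_smul_univ, smul_eq_mul, mul_comm]

lemma isHomogeneous_diagPoly {N : ℕ}
    (φ : ContinuousMultilinearMap ℂ (fun _ : Fin N => CxSpace n k) ℂ) :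
    (diagPoly φ).IsHomogeneous N := by
  refine IsHomogeneous.sum _ _ _ fun r _ => ?_
  have h1 : (∏ a, X (r a) : MvPolynomial (Fin n ⊕ Fin k) ℂ).IsHomogeneous (∑ _a : Fin N, 1) :=
    IsHomogeneous.prod _ _ _ fun a _ => isHomogeneous_X _ _
  have h2 := (isHomogeneous_C (Fin n ⊕ Fin k) (φ fun a => basisVec (r a))).mul h1
  simpa using h2

lemma weight_bounds (d : Fin n ⊕ Fin k →₀ ℕ) :
    (d.degree : ℤ) ≤ Finsupp.weight (varWeight n k) d ∧
      Finsupp.weight (varWeight n k) d ≤ 2 * (d.degree : ℤ) := by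
  rw [Finsupp.weight_apply, Finsupp.sum_fintype _ _ (by simp), Finsupp.degree_eq_sum]
  push_cast
  rw [Finset.mul_sum]
  constructor
  all_goals
    refine Finset.sum_le_sum fun x _ => ?_
    rcases x with x | x <;> simp [varWeight] <;> omega

variable (P : FormalMultilinearSeries ℂ (CxSpace n k) (CxSpace n k))

/-- The `∂/∂z`-components of the homogeneous terms of a power series. -/
def termFst (N : ℕ) (i : Fin n) : MvPolynomial (Fin n ⊕ Fin k) ℂ :=
  diagPoly (((ContinuousLinearMap.proj i).comp (ContinuousLinearMap.fst ℂ (Fin n → ℂ)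
    (Fin k → ℂ))).compContinuousMultilinearMap (P N))

/-- The `∂/∂w`-components of the homogeneous terms of a power series. -/
def termSnd (N : ℕ) (j : Fin k) : MvPolynomial (Fin n ⊕ Fin k) ℂ :=
  diagPoly (((ContinuousLinearMap.proj j).comp (ContinuousLinearMap.snd ℂ (Fin n → ℂ)
    (Fin k → ℂ))).compContinuousMultilinearMap (P N))

lemma isHomogeneous_termFst (i : Fin n) (N : ℕ) : (termFst P N i).IsHomogeneous N :=
  isHomogeneous_diagPoly _

lemma isHomogeneous_termSnd (j : Fin k) (N : ℕ) : (termSnd P N j).IsHomogeneous N :=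
  isHomogeneous_diagPoly _

lemma polyField_term (N : ℕ) (y : CxSpace n k) :
    polyField (termFst P N) (termSnd P N) y = P N fun _ => y := by
  refine Prod.ext (funext fun i => ?_) (funext fun j => ?_)
  · exact eval_diagPoly _ y
  · exact eval_diagPoly _ y

lemma polyField_sum_term (M : ℕ) (y : CxSpace n k) :
    polyField (fun i => ∑ N ∈ Finset.range M, termFst P N i)
      (fun j => ∑ N ∈ Finset.range M, termSnd P N j) y = P.partialSum M y := by
  simp only [FormalMultilinearSeries.partialSum, ← polyField_term]
  refine Prod.ext (funext fun i => ?_) (funext fun j => ?_)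
  · simp [polyField, Prod.fst_sum, Finset.sum_apply]
  · simp [polyField, Prod.snd_sum, Finset.sum_apply]

lemma coeff_sum_of_isHomogeneous {q : ℕ → MvPolynomial (Fin n ⊕ Fin k) ℂ}
    (hq : ∀ N, (q N).IsHomogeneous N) {d : Fin n ⊕ Fin k →₀ ℕ} {M : ℕ} (hd : d.degree < M) :
    coeff d (∑ N ∈ Finset.range M, q N) = coeff d (q d.degree) := by
  rw [coeff_sum]
  refine Finset.sum_eq_single_of_mem _ (Finset.mem_range.2 hd) fun N _ hN => ?_
  exact (hq N).coeff_eq_zero (Ne.symm hN)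

end Jets

/-! ### Tangent germs are polynomial -/

section Decomposition

variable {n : ℕ} {Q : CRQuadric n 3}

lemma coeff_term_eq_zero (hQ : Q.Nondegenerate) {Y : CxSpace n 3 → CxSpace n 3}
    {P : FormalMultilinearSeries ℂ (CxSpace n 3) (CxSpace n 3)} (hP : HasFPowerSeriesAt Y P 0)
    (htan : ∀ᶠ p in 𝓝 0, p ∈ Q.carrier → Q.tangency p (Y p) = 0)
    (d : Fin n ⊕ Fin 3 →₀ ℕ) :
    (4 ≤ Finsupp.weight (varWeight n 3) d → ∀ i, coeff d (termFst P d.degree i) = 0) ∧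
      (5 ≤ Finsupp.weight (varWeight n 3) d → ∀ j, coeff d (termSnd P d.degree j) = 0) := by
  -- The weight of `d` is at most twice its degree, so this jet order exceeds `m + 2` for both `m =
  -- a - 1` and `m = a - 2`.
  set M := 2 * d.degree + 5 with hM
  set a := Finsupp.weight (varWeight n 3) d with ha
  have hda := weight_bounds d
  rw [← ha] at hda
  have hO : (fun y => Y y - polyField (fun i => ∑ N ∈ Finset.range M, termFst P N i)
      (fun j => ∑ N ∈ Finset.range M, termSnd P N j) y) =O[𝓝 0] fun y => ‖y‖ ^ M := by
    simp only [polyField_sum_term]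
    simpa using hP.isBigO_sub_partialSum_pow M
  have key : ∀ m : ℤ, 3 ≤ m → m + 2 < M → _ := fun m h3 hm =>
    eq_zero_of_three_le_weight hQ h3
      (fun i => weightedHomogeneousComponent_isWeightedHomogeneous _ _)
      (fun j => weightedHomogeneousComponent_isWeightedHomogeneous _ _)
      (fun p hp => Q.tangency_weightPart hO htan hm hp)
  have hdeg : d.degree < M := by omega
  constructor
  · intro h4 i
    have h1 := congrFun (key (a - 1) (by omega) (by push_cast [hM]; omega)).1 i
    have h2 := congrArg (coeff d) h1
    simp only [sub_add_cancel, coeff_weightedHomogeneousComponent, ← ha, if_true] at h2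
    rw [coeff_sum_of_isHomogeneous (isHomogeneous_termFst P i) hdeg] at h2
    simpa using h2
  · intro h5 j
    have h1 := congrFun (key (a - 2) (by omega) (by push_cast [hM]; omega)).2 j
    have h2 := congrArg (coeff d) h1
    simp only [sub_add_cancel, coeff_weightedHomogeneousComponent, ← ha, if_true] at h2
    rw [coeff_sum_of_isHomogeneous (isHomogeneous_termSnd P j) hdeg] at h2
    simpa using h2

lemma coeff_sum_range_eq_zero {q : ℕ → MvPolynomial (Fin n ⊕ Fin 3) ℂ}
    (hq : ∀ N, (q N).IsHomogeneous N) {b : ℤ}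
    (h : ∀ d, b ≤ Finsupp.weight (varWeight n 3) d → coeff d (q d.degree) = 0) (M : ℕ)
    (d : Fin n ⊕ Fin 3 →₀ ℕ) (hd : coeff d (∑ N ∈ Finset.range M, q N) ≠ 0) :
    0 ≤ Finsupp.weight (varWeight n 3) d ∧ Finsupp.weight (varWeight n 3) d < b := by
  have h0 := (weight_bounds d).1
  refine ⟨by omega, ?_⟩
  by_contra! hb
  apply hd
  by_cases hM : d.degree < M
  · rw [coeff_sum_of_isHomogeneous hq hM, h d hb]
  · rw [coeff_sum]
    refine Finset.sum_eq_zero fun N hN => (hq N).coeff_eq_zero ?_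
    have := Finset.mem_range.1 hN
    omega

/-- Every tangent field is a polynomial field with parts of weights `-2, …, 2`. -/
lemma aut_le (hQ : Q.Nondegenerate) :
    Q.aut ≤ Q.autComp (-2) ⊔ Q.autComp (-1) ⊔ Q.autComp 0 ⊔ Q.autComp 1 ⊔ Q.autComp 2 := by
  rintro _ ⟨Y, rfl, ⟨P, hP⟩, htan⟩
  simp only [fderiv_definingFun] at htan
  have hcoeff := coeff_term_eq_zero hQ hP htan
  let f : Fin n → MvPolynomial (Fin n ⊕ Fin 3) ℂ := fun i => ∑ N ∈ Finset.range 5, termFst P N i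
  let g : Fin 3 → MvPolynomial (Fin n ⊕ Fin 3) ℂ := fun j => ∑ N ∈ Finset.range 5, termSnd P N j
  -- A monomial's weight is at least its degree, so from degree five on all coefficients of both
  -- components vanish.
  have hterm : ∀ N, 5 ≤ N → ∀ y, (P N fun _ => y) = 0 := by
    intro N hN y
    have hf : termFst P N = 0 := by
      ext i d
      by_cases hd : d.degree = N
      · subst hd
        simpa using (hcoeff d).1 (by have := (weight_bounds d).1; omega) i
      · simpa using (isHomogeneous_termFst P i N).coeff_eq_zero hd
    have hg : termSnd P N = 0 := by
      ext j d
      by_cases hd : d.degree = N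
      · subst hd
        simpa using (hcoeff d).2 (by have := (weight_bounds d).1; omega) j
      · simpa using (isHomogeneous_termSnd P j N).coeff_eq_zero hd
    rw [← polyField_term, hf, hg]
    exact Prod.ext (funext fun i => by simp [polyField]) (funext fun j => by simp [polyField])
  have heq : Y =ᶠ[𝓝 0] polyField f g := by
    filter_upwards [hP.eventually_hasSum] with y hy
    rw [zero_add] at hy
    rw [polyField_sum_term]
    exact hy.unique (hasSum_sum_of_ne_finset_zero fun N hN => hterm N (by simpa using hN) y)
  have hsum : polyField f g = weightPart f g (-2) + weightPart f g (-1) + weightPart f g 0 +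
      weightPart f g 1 + weightPart f g 2 := by
    funext p
    rw [polyField_eq_sum_weightPart f g (S := {-2, -1, 0, 1, 2}) ?_ ?_ p]
    · simp [add_assoc]
    · intro i d hd
      have := coeff_sum_range_eq_zero (isHomogeneous_termFst P i)
        (fun d hd => (hcoeff d).1 hd i) 5 d hd
      simp only [Finset.mem_insert, Finset.mem_singleton]
      omega
    · intro j d hd
      have := coeff_sum_range_eq_zero (isHomogeneous_termSnd P j)
        (fun d hd => (hcoeff d).2 hd j) 5 d hd
      simp only [Finset.mem_insert, Finset.mem_singleton]
      omega
  have hmem : ∀ m : ℤ, m ≤ 2 → (weightPart f g m : FieldGerm n 3) ∈ Q.autComp m := by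
    intro m hm
    refine ⟨⟨_, rfl, ?_, Eventually.of_forall fun p hp => ?_⟩, _, _, rfl,
      fun i => weightedHomogeneousComponent_isWeightedHomogeneous _ _,
      fun j => weightedHomogeneousComponent_isWeightedHomogeneous _ _⟩
    · exact (contDiff_polyField _ _).contDiffAt.analyticAt
    · rw [fderiv_definingFun]
      -- The error is zero near the origin, so `M` only has to exceed `m + 2 ≤ 4`.
      refine Q.tangency_weightPart (M := 5) ?_ htan (by push_cast; omega) hp
      refine IsBigO.congr' (isBigO_zero _ _) ?_ EventuallyEq.rfl
      filter_upwards [heq] with y hy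
      rw [hy, sub_self]
  rw [Germ.coe_eq.2 heq, hsum]
  refine Submodule.add_mem_sup (Submodule.add_mem_sup (Submodule.add_mem_sup
    (Submodule.add_mem_sup (hmem _ ?_) (hmem _ ?_)) (hmem _ ?_)) (hmem _ ?_)) (hmem _ ?_) <;>
  norm_num

end Decomposition

/-! ### Independence of the weight spaces -/

section Independence

variable (n k : ℕ)

lemma tendsto_dilate (s : ℂ) : Tendsto (dilate s : CxSpace n k → CxSpace n k) (𝓝 0) (𝓝 0) := by
  have hc : Continuous (dilate s : CxSpace n k → CxSpace n k) := by
    unfold dilate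
    fun_prop
  have h0 : dilate s (0 : CxSpace n k) = 0 := by simp [dilate]
  simpa only [h0] using hc.tendsto 0

/-- The pullback of germs of fields under the dilation `(z, w) ↦ (2z, 4w)`. -/
def pullbackDilate : Module.End ℝ (FieldGerm n k) where
  toFun G := (G.compTendsto _ (tendsto_dilate n k 2)).map (dilate 2⁻¹)
  map_add' G G' := by
    induction G using Germ.inductionOn with | _ X
    induction G' using Germ.inductionOn with | _ X'
    refine congrArg Germ.ofFun (funext fun p => ?_)
    simp [dilate]
  map_smul' c G := by
    induction G using Germ.inductionOn with | _ X
    refine congrArg Germ.ofFun (funext fun p => ?_)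
    simp [dilate, smul_comm c]

/-- The components scale by `2 ^ (m + 1)` and `2 ^ (m + 2)`, and the inverse dilation of the values
divides them by `2` and `4`. -/
lemma weightSpace_le_eigenspace (m : ℤ) :
    weightSpace n k m ≤ (pullbackDilate n k).eigenspace ((2 : ℝ) ^ m) := by
  rintro _ ⟨f, g, rfl, hf, hg⟩
  rw [Module.End.mem_eigenspace_iff]
  refine congrArg Germ.ofFun (funext fun p => ?_)
  simp only [Function.comp_apply, polyField_dilate hf hg two_ne_zero]
  have h2 : (2 : ℂ) ≠ 0 := two_ne_zero
  refine Prod.ext (funext fun i => ?_) (funext fun j => ?_)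
  · simp [dilate, zpow_add₀ h2]
    ring
  · simp [dilate, zpow_add₀ h2]
    ring

lemma iSupIndep_weightSpace : iSupIndep (weightSpace n k) := by
  refine ((pullbackDilate n k).eigenspaces_iSupIndep.comp
    (f := fun m : ℤ => (2 : ℝ) ^ m) ?_).mono (weightSpace_le_eigenspace n k)
  exact zpow_right_injective₀ two_pos (by norm_num)

end Independence

end CRQuadric

end

theorem mainTheorem2 {n : ℕ} (Q : CRQuadric n 3) (hQ : Q.Nondegenerate) :
    ¬ Q.IsExceptional ∧
      Q.aut = Q.autComp (-2) ⊔ Q.autComp (-1) ⊔ Q.autComp 0 ⊔ Q.autComp 1 ⊔ Q.autComp 2 ∧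
      iSupIndep Q.autComp := by
  have hind : iSupIndep Q.autComp :=
    (CRQuadric.iSupIndep_weightSpace n 3).mono fun m => inf_le_right
  have hle := CRQuadric.aut_le hQ
  refine ⟨fun h => h.2 ?_, le_antisymm hle ?_, hind⟩
  -- `g₃` lies in the sum of the components of weights `-2, …, 2` and, by independence, meets it
  -- only in zero.
  · refine disjoint_self.1 ((hind 3).mono_right (inf_le_left.trans (hle.trans ?_)))
    refine sup_le (sup_le (sup_le (sup_le ?_ ?_) ?_) ?_) ?_ <;>
    exact le_iSup₂_of_le _ (by norm_num) le_rfl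
  · exact sup_le (sup_le (sup_le (sup_le inf_le_left inf_le_left) inf_le_left) inf_le_left)
      inf_le_left
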